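/- Let $V$ be a finite vertex set with $n=|V|\ge 2$, let $c$ be a metric on $V$ ($c_{ij}=c_{ji}\ge 0$ and $c_{ik}\le c_{ij}+c_{jk}$ for all $i,j,k\in V$), let $r\in V$ be the depot, and let $\pi:V\to\mathbb R_{\ge 0}$ be penalties. A cycle through $r$ is a cyclic order on a set $V(T)\subseteq V$ with $r\in V(T)$; $c(T)$ is the sum of the costs of its edges (a one-vertex cycle costs $0$, a two-vertex cycle uses its edge twice), and $\pi(S)=\sum_{v\in S}\pi(v)$. Let $E$ be the edge set of the complete graph on $V$, and let $(x^*,y^*)\in\mathbb R^E\times\mathbb R^V$ be an optimum solution of the linear program $$\min\ c(x)+\pi(\mathbf 1-y)=\sum_{e\in E}c_ex_e+\sum_{v\in V}\pi(v)(1-y_v)$$ subject to $x(\delta(v))=2y_v$ for $v\in V\setminus\{r\}$; $x(\delta(S))\ge 2y_v$ for $S\subset V$, $r\notin S$, $v\in S$; $0\le x_e\le 1$ for $e\in E$; $0\le y_v\le 1$ for $v\in V$; $y_r=1$. The Goemans–Williamson primal-dual algorithm for the prize-collecting TSP with costs $c$, penalties $\rho$ and depot $r$ is the following. Start with the forest $F=\emptyset$,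 with the singletons as components, all active except $\{r\}$, with all vertices unlabelled, and with dual variables $y_S=0$ for all $S\subseteq V\setminus\{r\}$. While some component is active, raise the variables $y_C$ of all active components $C$ uniformly by the smallest amount after which one of the following is an equality: $\sum_{S:\,i\in S}y_S+\sum_{S:\,j\in S}y_S\le c_{ij}$ for an edge $ij$ between two different components that are not both inactive, or $\sum_{S\subseteq C}y_S\le\sum_{i\in C}\rho(i)/2$ for an active component $C$. Process one of the constraints that have become tight, breaking ties arbitrarily: in the first case add $ij$ to $F$ and merge the two components into one, which is active if and only if it does not contain $r$; in the second case make $C$ inactive and give all its unlabelled vertices the label $C$. When no component is active, let $F'\subseteq F$ be obtained by removing as many edges as possible such that every unlabelled vertex is connected to $r$ in $F'$ and such that, if a vertex with label $C$ is connected to $r$ in $F'$, then so is every vertex with a label $C'\supseteq C$. Double all edges of the tree $F'$, take an Eulerian tour through $r$ of the resulting multigraph, and return a cycle obtained from the tour by shortcutting (keeping one occurrence of each vertex, in the order of the tour). Every execution of this algorithm with the penalties $$\rho(v)=\pi'(v)=\frac{1}{2-1/(n-1)}\,\pi(v)$$ terminates and returns a cycle through $r$, and every cycle $T_{pd}$ that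 it can return satisfies $$c(T_{pd})+\pi(V\setminus V(T_{pd}))\le 2c(x^*)+\pi(\mathbf 1-y^*).$$ -/

import Mathlib

namespace PCTSP

variable {V : Type*} [Fintype V] [DecidableEq V]

/-- `c` is a metric in the sense used for the prize-collecting TSP: symmetric (built in, since `c`
is a function of the unordered pair), non-negative, and satisfying the triangle inequality. -/
structure IsMetric (c : Sym2 V → ℝ) : Prop where
  nonneg : ∀ i j : V, 0 ≤ c s(i, j)
  triangle : ∀ i j k : V, c s(i, k) ≤ c s(i, j) + c s(j, k)

/-! ### The linear programming relaxation -/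

/-- The edge set of the complete graph on `V`. -/
def edges (V : Type*) [Fintype V] [DecidableEq V] : Finset (Sym2 V) :=
  Finset.univ.filter (fun e => ¬ e.IsDiag)

open Classical in
/-- `δ(S)`: the edges of the complete graph with exactly one endpoint in `S`. -/
noncomputable def cut (S : Finset V) : Finset (Sym2 V) :=
  (edges V).filter (fun e => (∃ u ∈ e, u ∈ S) ∧ (∃ v ∈ e, v ∉ S))

/-- The edge part `c(x)` of the objective. -/
noncomputable def edgeCost (c x : Sym2 V → ℝ) : ℝ := ∑ e ∈ edges V, c e * x e

/-- The penalty part `π(1 - y)` of the objective. -/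
noncomputable def penaltyCost (π y : V → ℝ) : ℝ := ∑ v, π v * (1 - y v)

/-- Feasible solutions of the LP relaxation with depot `r`. -/
structure Feasible (r : V) (x : Sym2 V → ℝ) (y : V → ℝ) : Prop where
  degree : ∀ v, v ≠ r → ∑ e ∈ cut {v}, x e = 2 * y v
  cuts : ∀ S : Finset V, r ∉ S → ∀ v ∈ S, 2 * y v ≤ ∑ e ∈ cut S, x e
  x_bounds : ∀ e ∈ edges V, 0 ≤ x e ∧ x e ≤ 1
  y_bounds : ∀ v, 0 ≤ y v ∧ y v ≤ 1
  y_root : y r = 1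

/-- Optimum solutions of the LP relaxation. -/
def IsOptimum (c : Sym2 V → ℝ) (π : V → ℝ) (r : V) (x : Sym2 V → ℝ) (y : V → ℝ) : Prop :=
  Feasible r x y ∧ ∀ x' y', Feasible r x' y' →
    edgeCost c x + penaltyCost π y ≤ edgeCost c x' + penaltyCost π y'

/-! ### Cycles through the depot -/

/-- A cycle is given by the list of its vertices in cyclic order, without repetition; it has to
visit the depot. The one-vertex cycle and the two-vertex cycle (an edge and back) are allowed. -/
structure IsCycleThrough (r : V) (T : List V) : Prop where
  nodup : T.Nodup
  root_mem : r ∈ T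

/-- `c(T)`: the sum of the costs of the edges of the cycle (the one-vertex cycle has no edge, the
two-vertex cycle uses its edge twice). -/
noncomputable def cycleCost (c : Sym2 V → ℝ) (T : List V) : ℝ :=
  if 2 ≤ T.length then (List.zipWith (fun u v => c s(u, v)) T (T.rotate 1)).sum else 0

/-- `π(V ∖ V(T))`: the penalties of the vertices that are not on the cycle. -/
noncomputable def missedPenalty (π : V → ℝ) (T : List V) : ℝ :=
  ∑ v ∈ Finset.univ.filter (fun v => v ∉ T), π v

/-! ### The Goemans–Williamson algorithm: growing phase for the prize-collecting Steiner tree -/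

/-- The variables of the growing phase. -/
structure PDState (V : Type*) where
  /-- the forest `F` of the edges selected so far -/
  forest : Finset (Sym2 V)
  /-- the current components -/
  comps : Finset (Finset V)
  /-- the components `C` that are active, i.e. `λ(C) = 1`; for all others `λ(C) = 0` -/
  active : Finset (Finset V)
  /-- `d v`: the sum of the dual variables `y_S` over the sets `S` containing `v` -/
  d : V → ℝ
  /-- `w C`: the sum of the dual variables `y_S` over the sets `S ⊆ C` -/
  w : Finset V → ℝ
  /-- the label of a vertex: the component by whose deactivation it was labelled, if any -/
  label : V → Option (Finset V)

namespace PDState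

/-- Initially `F` is empty, every vertex is a component, all components but that of the root are
active, all dual variables are zero, and no vertex is labelled. -/
def init (r : V) : PDState V where
  forest := ∅
  comps := Finset.univ.image (fun v => {v})
  active := (Finset.univ.erase r).image (fun v => {v})
  d := fun _ => 0
  w := fun _ => 0
  label := fun _ => none

/-- `λ(C)`. -/
def lam (s : PDState V) (C : Finset V) : ℝ := if C ∈ s.active then 1 else 0

/-- `(i, j)` joins two different components `Cp ∋ i`, `Cq ∋ j`, not both inactive. (For edges
between two inactive components the time until they become tight is infinite.) -/
structure Candidate (s : PDState V) (Cp Cq : Finset V) (i j : V) : Prop where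
  left_mem : Cp ∈ s.comps
  right_mem : Cq ∈ s.comps
  ne : Cp ≠ Cq
  i_mem : i ∈ Cp
  j_mem : j ∈ Cq
  grows : Cp ∈ s.active ∨ Cq ∈ s.active

/-- The time after which the edge `(i, j)` between `Cp` and `Cq` becomes tight. -/
noncomputable def edgeTime (c : Sym2 V → ℝ) (s : PDState V) (Cp Cq : Finset V) (i j : V) : ℝ :=
  (c s(i, j) - s.d i - s.d j) / (s.lam Cp + s.lam Cq)

/-- The time after which the penalty constraint of the active component `C` becomes tight. -/
noncomputable def penaltyTime (π : V → ℝ) (s : PDState V) (C : Finset V) : ℝ :=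
  ∑ i ∈ C, π i - s.w C

/-- Raise the dual variables of all active components by `ε`. -/
def grow (s : PDState V) (ε : ℝ) : PDState V where
  forest := s.forest
  comps := s.comps
  active := s.active
  d := fun v => if ∃ C ∈ s.active, v ∈ C then s.d v + ε else s.d v
  w := fun C => if C ∈ s.active then s.w C + ε else s.w C
  label := s.label

/-- Add the edge `(i, j)` to the forest and merge `Cp` and `Cq`; the new component is active
unless it contains the root. -/
def merge (r : V) (s : PDState V) (Cp Cq : Finset V) (i j : V) : PDState V where
  forest := insert s(i, j) s.forest
  comps := insert (Cp ∪ Cq) ((s.comps.erase Cp).erase Cq)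
  active :=
    if r ∈ Cp ∪ Cq then (s.active.erase Cp).erase Cq
    else insert (Cp ∪ Cq) ((s.active.erase Cp).erase Cq)
  d := s.d
  w := Function.update s.w (Cp ∪ Cq) (s.w Cp + s.w Cq)
  label := s.label

/-- Deactivate the component `C` and label its unlabelled vertices with `C`. -/
def deactivate (s : PDState V) (C : Finset V) : PDState V where
  forest := s.forest
  comps := s.comps
  active := s.active.erase C
  d := s.d
  w := s.w
  label := fun v => if v ∈ C ∧ s.label v = none then some C else s.label v

/-- One iteration of the main loop, for the costs `c`, penalties `π` and root `r`: the dual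
variables of the active components are raised by the smallest amount after which an edge or a
penalty constraint becomes tight, and one of the constraints that have become tight is processed.
Ties may be broken in any way. -/
inductive Step (c : Sym2 V → ℝ) (π : V → ℝ) (r : V) (s : PDState V) : PDState V → Prop
  | edge (Cp Cq : Finset V) (i j : V) (h : s.Candidate Cp Cq i j)
      (hedge : ∀ Cp' Cq' i' j', s.Candidate Cp' Cq' i' j' →
        s.edgeTime c Cp Cq i j ≤ s.edgeTime c Cp' Cq' i' j')
      (hpen : ∀ C ∈ s.active, s.edgeTime c Cp Cq i j ≤ s.penaltyTime π C) :
      Step c π r s ((s.grow (s.edgeTime c Cp Cq i j)).merge r Cp Cq i j)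
  | penalty (C : Finset V) (h : C ∈ s.active)
      (hpen : ∀ C' ∈ s.active, s.penaltyTime π C ≤ s.penaltyTime π C')
      (hedge : ∀ Cp' Cq' i' j', s.Candidate Cp' Cq' i' j' →
        s.penaltyTime π C ≤ s.edgeTime c Cp' Cq' i' j') :
      Step c π r s ((s.grow (s.penaltyTime π C)).deactivate C)

/-- `s` occurs during some execution of the growing phase. -/
def Reachable (c : Sym2 V → ℝ) (π : V → ℝ) (r : V) (s : PDState V) : Prop :=
  Relation.ReflTransGen (Step c π r) (init r) s

/-- The growing phase stops when no component is active. -/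
def Halted (s : PDState V) : Prop := s.active = ∅

end PDState

/-! ### Pruning phase, and the cycle -/

/-- The graph on `V` with edge set `F`. -/
abbrev graphOf (F : Finset (Sym2 V)) : SimpleGraph V :=
  SimpleGraph.fromEdgeSet (F : Set (Sym2 V))

/-- A subset `F'` of the forest is admissible if (i) every unlabelled vertex is connected to the
root in `F'`, and (ii) if a vertex with label `C` is connected to the root in `F'`, then so is
every vertex with a label `C' ⊇ C`. -/
structure Admissible (r : V) (s : PDState V) (F' : Finset (Sym2 V)) : Prop where
  subset : F' ⊆ s.forest
  unlabelled : ∀ v, s.label v = none → (graphOf F').Reachable r v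
  labelled : ∀ v v' C C', s.label v = some C → s.label v' = some C' → C ⊆ C' →
    (graphOf F').Reachable r v → (graphOf F').Reachable r v'

/-- The result of removing as many edges as possible from the forest, keeping admissibility. -/
def IsPruned (r : V) (s : PDState V) (F' : Finset (Sym2 V)) : Prop :=
  Minimal (Admissible r s) F'

/-- `T` is obtained from the tree `F'` by doubling every edge, taking an Eulerian tour of the
resulting multigraph (a closed walk through `r` that uses every edge of `F'` exactly twice), and
shortcutting it (keeping exactly one occurrence of every vertex, in the order of the tour). -/
def IsDoubledTreeTour (r : V) (F' : Finset (Sym2 V)) (T : List V) : Prop :=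
  ∃ p : (graphOf F').Walk r r, (∀ e ∈ F', p.edges.count e = 2) ∧
    T.Sublist p.support ∧ T.Nodup ∧ ∀ v ∈ p.support, v ∈ T

/-- The cycle `T` may be returned when the growing phase has ended in the state `s`. -/
def Returns (r : V) (s : PDState V) (T : List V) : Prop :=
  s.Halted ∧ ∃ F', IsPruned r s F' ∧ IsDoubledTreeTour r F' T

/-- One iteration of the Goemans–Williamson algorithm for the prize-collecting TSP with costs `c`,
penalties `π` and depot `r`: its growing phase is that for the prize-collecting Steiner tree
problem with the same costs and halved penalties. -/
def TSPStep (c : Sym2 V → ℝ) (π : V → ℝ) (r : V) : PDState V → PDState V → Prop :=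
  PDState.Step c (fun v => π v / 2) r

/-- The state `s` occurs during some execution of the algorithm for the prize-collecting TSP. -/
def TSPReachable (c : Sym2 V → ℝ) (π : V → ℝ) (r : V) (s : PDState V) : Prop :=
  PDState.Reachable c (fun v => π v / 2) r s

/-- `T` is a possible output of the Goemans–Williamson algorithm for the prize-collecting TSP. -/
def IsOutput (c : Sym2 V → ℝ) (π : V → ℝ) (r : V) (T : List V) : Prop :=
  ∃ s, TSPReachable c π r s ∧ Returns r s T

/-- Every execution of the algorithm ends after finitely many iterations and returns something:
there is no infinite execution, and whenever no further iteration is possible, a cycle is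
returned. -/
def AlwaysReturns (c : Sym2 V → ℝ) (π : V → ℝ) (r : V) : Prop :=
  Acc (fun s' s => TSPStep c π r s s') (PDState.init r) ∧
    ∀ s, TSPReachable c π r s → (∃ s', TSPStep c π r s s') ∨ ∃ T, Returns r s T

/-- The scaled penalties `π' = π / (2 - 1/(n-1))`, where `n = |V|`. -/
noncomputable def scaledPenalty (π : V → ℝ) : V → ℝ :=
  fun v => 1 / (2 - 1 / ((Fintype.card V : ℝ) - 1)) * π v

end PCTSP

set_option linter.unusedSectionVars false

namespace PCTSP

variable {V : Type*} [Fintype V] [DecidableEq V]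

/-! Put α = 2 - 1/(n-1) and p = π'/2 = π/(2α), the penalties with which the growing phase runs, and
let Y be the dual solution that it builds and F a pruned tree. The sets S in the support of Y are
split by F.

Sets meeting the tree pay for its edges. Forest edges are tight, so c(F) ≤ ∑ Y_S |F ∩ δ(S)|. At each
moment the active sets that meet the tree have average degree at most α in F
(`sum_active_card_inter_cut_le`), hence c(F) is at most α times the total of their dual variables.
Sets disjoint from the tree pay for the missed penalties: the missed vertices form a union of
labels, and the penalty constraint of a label was tight (`IsDual.sum_penalty_le`). Together, c(F) +
α p(missed) ≤ α ∑ Y_S.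

It remains to bound ∑ Y_S by c(x)/2 + ∑ p(v)(1 - y_v). With m(S) = max_S y, write Y_S = Y_S m(S) +
Y_S (1 - m(S)). The first parts sum to at most c(x)/2, because 2 m(S) ≤ x(δ(S)) and Y respects the
edge costs. The second parts sum to at most ∑ p(v)(1 - y_v), because 1 - m is antitone and at every
time the dual variables inside a component total at most its penalty; this is the invariant
`weighted` of `IsDual`, used in `IsDual.sum_mul_le`.

Doubling the tree doubles the inequality. Since 2αp = π, it becomes 2c(F) + π(missed) ≤ α c(x) + π(1
- y), and α ≤ 2. -/

theorem mem_cut {S : Finset V} {a b : V} :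
    s(a, b) ∈ cut S ↔ (a ∈ S ∧ b ∉ S) ∨ (a ∉ S ∧ b ∈ S) := by
  simp only [cut, edges, Finset.mem_filter, Finset.mem_univ, true_and, Sym2.mk_isDiag_iff,
    Sym2.mem_iff]
  constructor
  · rintro ⟨hab, ⟨u, rfl | rfl, hu⟩, ⟨v, rfl | rfl, hv⟩⟩ <;> tauto
  · rintro (⟨ha, hb⟩ | ⟨ha, hb⟩)
    · exact ⟨fun h => hb (h ▸ ha), ⟨a, .inl rfl, ha⟩, ⟨b, .inr rfl, hb⟩⟩
    · exact ⟨fun h => ha (h ▸ hb), ⟨b, .inr rfl, hb⟩, ⟨a, .inl rfl, ha⟩⟩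

/-! ### Connectivity to the root, and pruned trees -/

theorem graphOf_mono {F F' : Finset (Sym2 V)} (h : F ⊆ F') : graphOf F ≤ graphOf F' :=
  SimpleGraph.fromEdgeSet_mono (by exact_mod_cast h)

theorem graphOf_adj {F : Finset (Sym2 V)} {a b : V} :
    (graphOf F).Adj a b ↔ s(a, b) ∈ F ∧ a ≠ b := by
  simp [graphOf]

/-- A property which holds at `a` and is inherited along edges holds at all vertices reachable
from `a`. -/
theorem reachable_induction {F : Finset (Sym2 V)} {a b : V} (P : V → Prop)
    (h : (graphOf F).Reachable a b) (ha : P a)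
    (hstep : ∀ u v, (graphOf F).Reachable a u → s(u, v) ∈ F → u ≠ v → P u → P v) : P b := by
  rw [SimpleGraph.reachable_iff_reflTransGen] at h
  induction h with
  | refl => exact ha
  | tail h₁ h₂ ih =>
    rw [graphOf_adj] at h₂
    exact hstep _ _ ((SimpleGraph.reachable_iff_reflTransGen _ _).2 h₁) h₂.1 h₂.2 ih

open Classical in
/-- The vertices that are connected to `r` by `F`. -/
noncomputable def spanned (r : V) (F : Finset (Sym2 V)) : Finset V :=
  Finset.univ.filter (fun v => (graphOf F).Reachable r v)

theorem mem_spanned {r v : V} {F : Finset (Sym2 V)} :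
    v ∈ spanned r F ↔ (graphOf F).Reachable r v := by
  simp [spanned]

theorem root_mem_spanned (r : V) (F : Finset (Sym2 V)) : r ∈ spanned r F :=
  mem_spanned.2 (SimpleGraph.Reachable.refl r)

/-- Some edge leaves a set that contains exactly one of `r` and `v`, if `v` is connected to `r`. -/
theorem exists_mem_cut {r v : V} {F : Finset (Sym2 V)} (h : v ∈ spanned r F) {C : Finset V}
    (hC : ¬ (r ∈ C ↔ v ∈ C)) : (F ∩ cut C).Nonempty := by
  by_contra hne
  rw [Finset.not_nonempty_iff_eq_empty] at hne
  refine hC (reachable_induction (fun w => r ∈ C ↔ w ∈ C) (mem_spanned.1 h) Iff.rfl ?_)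
  intro a b _ hab _ ih
  have : s(a, b) ∉ F ∩ cut C := by simp [hne]
  rw [Finset.mem_inter, mem_cut] at this
  tauto

/-- Every edge of a pruned tree is connected to the root. -/
theorem IsPruned.mem_spanned_left {r : V} {s : PDState V} {F : Finset (Sym2 V)}
    (h : IsPruned r s F) {a b : V} (hab : s(a, b) ∈ F) : a ∈ spanned r F := by
  by_contra ha
  rw [mem_spanned] at ha
  have key : ∀ v, (graphOf F).Reachable r v → (graphOf (F.erase s(a, b))).Reachable r v := by
    intro v hv
    refine reachable_induction (fun w => (graphOf (F.erase s(a, b))).Reachable r w) hv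
      (SimpleGraph.Reachable.refl r) ?_
    intro u w hu huw hne ih
    refine ih.trans (SimpleGraph.Adj.reachable (graphOf_adj.2 ⟨Finset.mem_erase.2 ⟨?_, huw⟩, hne⟩))
    intro he
    rcases Sym2.eq_iff.1 he with ⟨rfl, rfl⟩ | ⟨rfl, rfl⟩
    · exact ha hu
    · exact ha (hu.trans (SimpleGraph.Adj.reachable (graphOf_adj.2 ⟨huw, hne⟩)))
  have back : ∀ v, (graphOf (F.erase s(a, b))).Reachable r v → (graphOf F).Reachable r v :=
    fun v hv => hv.mono (graphOf_mono (Finset.erase_subset _ _))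
  have hadm : Admissible r s (F.erase s(a, b)) :=
    { subset := (Finset.erase_subset _ _).trans h.1.subset
      unlabelled := fun v hv => key v (h.1.unlabelled v hv)
      labelled := fun v v' C C' hv hv' hC hr =>
        key v' (h.1.labelled v v' C C' hv hv' hC (back v hr)) }
  have := h.2 hadm (Finset.erase_subset _ _) hab
  simp at this

theorem IsPruned.mem_spanned_right {r : V} {s : PDState V} {F : Finset (Sym2 V)}
    (h : IsPruned r s F) {a b : V} (hab : s(a, b) ∈ F) : b ∈ spanned r F :=
  h.mem_spanned_left (b := a) (Sym2.eq_swap ▸ hab)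

/-- A set all of whose vertices are labelled by subsets of it is not a leaf of a pruned tree. -/
theorem IsPruned.card_inter_cut_ne_one {r : V} {s : PDState V} {F : Finset (Sym2 V)}
    (h : IsPruned r s F) {C : Finset V} (hr : r ∉ C)
    (hmem : ∀ v L, s.label v = some L → v ∈ L)
    (hC : ∀ v ∈ C, ∃ L, L ⊆ C ∧ s.label v = some L) : (F ∩ cut C).card ≠ 1 := by
  intro hcard
  obtain ⟨e, he⟩ := Finset.card_eq_one.1 hcard
  have heF : e ∈ F ∩ cut C := by simp [he]
  obtain ⟨a, b, rfl, ha, hb⟩ : ∃ a b, e = s(a, b) ∧ a ∈ C ∧ b ∉ C := by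
    induction e with
    | _ a b =>
      rcases mem_cut.1 (Finset.mem_inter.1 heF).2 with h' | h'
      · exact ⟨a, b, rfl, h'⟩
      · exact ⟨b, a, Sym2.eq_swap, h'.2, h'.1⟩
  have uniq : ∀ u v, s(u, v) ∈ F → u ∈ C → v ∉ C → u = a ∧ v = b := by
    intro u v huv hu hv
    have : s(u, v) ∈ F ∩ cut C := Finset.mem_inter.2 ⟨huv, mem_cut.2 (.inl ⟨hu, hv⟩)⟩
    rw [he, Finset.mem_singleton, Sym2.eq_iff] at this
    rcases this with h' | ⟨rfl, rfl⟩
    · exact h'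
    · exact absurd hu hb
  -- A path from r can enter or leave C only along the edge ab, whose outer end is b. So a path that
  -- has entered C has passed b, and it continues outside from b again: deleting ab loses no vertex
  -- outside C.
  have key : ∀ v, (graphOf F).Reachable r v →
      (v ∉ C → (graphOf (F.erase s(a, b))).Reachable r v) ∧
      (v ∈ C → (graphOf (F.erase s(a, b))).Reachable r b) := by
    intro v hv
    refine reachable_induction (fun v => (v ∉ C → (graphOf (F.erase s(a, b))).Reachable r v) ∧
      (v ∈ C → (graphOf (F.erase s(a, b))).Reachable r b)) hv
      ⟨fun _ => SimpleGraph.Reachable.refl r, fun h => absurd h hr⟩ ?_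
    intro u v _ huv hne ih
    by_cases hu : u ∈ C <;> by_cases hv : v ∈ C
    · exact ⟨fun h => absurd hv h, fun _ => ih.2 hu⟩
    · obtain ⟨rfl, rfl⟩ := uniq u v huv hu hv
      exact ⟨fun _ => ih.2 hu, fun h => absurd h hv⟩
    · obtain ⟨rfl, rfl⟩ := uniq v u (Sym2.eq_swap ▸ huv) hv hu
      exact ⟨fun h => absurd hv h, fun _ => ih.1 hu⟩
    · refine ⟨fun _ => (ih.1 hu).trans (SimpleGraph.Adj.reachable (graphOf_adj.2
        ⟨Finset.mem_erase.2 ⟨fun he => ?_, huv⟩, hne⟩)), fun h => absurd h hv⟩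
      rcases Sym2.eq_iff.1 he with ⟨rfl, rfl⟩ | ⟨rfl, rfl⟩
      · exact hu ha
      · exact hv ha
  have avoid : ∀ v, (graphOf (F.erase s(a, b))).Reachable r v → v ∉ C := by
    intro v hv
    refine reachable_induction (fun v => v ∉ C) hv hr ?_
    intro u v _ huv hne hu hv
    rw [Finset.mem_erase] at huv
    obtain ⟨rfl, rfl⟩ := uniq v u (Sym2.eq_swap ▸ huv.2) hv hu
    exact huv.1 Sym2.eq_swap
  have back : ∀ v, (graphOf (F.erase s(a, b))).Reachable r v → (graphOf F).Reachable r v :=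
    fun v hv => hv.mono (graphOf_mono (Finset.erase_subset _ _))
  -- Deleting ab cuts off exactly the part inside C. Neither condition demands it back: the vertices
  -- of C are labelled, and a vertex whose label lies in the label of a vertex of C is itself in C,
  -- hence also cut off.
  have hadm : Admissible r s (F.erase s(a, b)) :=
    { subset := (Finset.erase_subset _ _).trans h.1.subset
      unlabelled := by
        intro v hv
        refine (key v (h.1.unlabelled v hv)).1 fun hvC => ?_
        obtain ⟨L, _, hL⟩ := hC v hvC
        simp [hv] at hL
      labelled := by
        intro v v' L L' hv hv' hL hr'
        refine (key v' (h.1.labelled v v' L L' hv hv' hL (back v hr'))).1 fun hvC => ?_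
        obtain ⟨L₁, hL₁, hL₂⟩ := hC v' hvC
        rw [hv', Option.some.injEq] at hL₂
        subst hL₂
        exact avoid v hr' (hL₁ (hL (hmem v L hv))) }
  have := h.2 hadm (Finset.erase_subset _ _) (Finset.mem_inter.1 heF).1
  simp at this

namespace PDState

/-! ### Termination -/

/-- A merge loses one component and, since one of the two was active, creates no additional active
one; a deactivation keeps the components and loses an active one. -/
theorem Step.card_lt {c : Sym2 V → ℝ} {p : V → ℝ} {r : V} {s s' : PDState V}
    (h : Step c p r s s') :
    s'.comps.card + s'.active.card < s.comps.card + s.active.card := by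
  cases h with
  | edge Cp Cq i j h _ _ =>
    have h₁ : ((s.comps.erase Cp).erase Cq).card + 2 = s.comps.card := by
      have hq : Cq ∈ s.comps.erase Cp := Finset.mem_erase.2 ⟨h.ne.symm, h.right_mem⟩
      have := Finset.card_erase_add_one hq
      have := Finset.card_erase_add_one h.left_mem
      omega
    have h₂ : ((s.active.erase Cp).erase Cq).card + 1 ≤ s.active.card := by
      rcases h.grows with hp | hq
      · have := Finset.card_erase_add_one hp
        have := Finset.card_erase_le (s := s.active.erase Cp) (a := Cq)
        omega
      · rw [Finset.erase_right_comm]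
        have := Finset.card_erase_add_one hq
        have := Finset.card_erase_le (s := s.active.erase Cq) (a := Cp)
        omega
    have h₃ := Finset.card_insert_le (Cp ∪ Cq) ((s.comps.erase Cp).erase Cq)
    have h₄ := Finset.card_insert_le (Cp ∪ Cq) ((s.active.erase Cp).erase Cq)
    simp only [merge, grow]
    split_ifs <;> omega
  | penalty C h _ _ =>
    have := Finset.card_erase_add_one h
    simp only [deactivate, grow]
    omega

theorem acc_step (c : Sym2 V → ℝ) (p : V → ℝ) (r : V) (s : PDState V) :
    Acc (fun s' s => Step c p r s s') s :=
  (Subrelation.wf (r := InvImage (· < ·) fun s : PDState V => s.comps.card + s.active.card)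
    (fun h => h.card_lt) (InvImage.wf _ wellFounded_lt)).apply s

/-- As long as some component is active, an iteration can be carried out. -/
theorem exists_step (c : Sym2 V → ℝ) (p : V → ℝ) (r : V) (s : PDState V)
    (h : s.active.Nonempty) : ∃ s', Step c p r s s' := by
  obtain ⟨C, hC, hmin⟩ := s.active.exists_min_image (s.penaltyTime p) h
  by_cases hc : ∃ q : Finset V × Finset V × V × V, s.Candidate q.1 q.2.1 q.2.2.1 q.2.2.2
  · obtain ⟨⟨Cp, Cq, i, j⟩, hq, hqmin⟩ := Set.exists_min_image
      {q : Finset V × Finset V × V × V | s.Candidate q.1 q.2.1 q.2.2.1 q.2.2.2}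
      (fun q => s.edgeTime c q.1 q.2.1 q.2.2.1 q.2.2.2) (Set.toFinite _) hc
    have hqmin' : ∀ Cp' Cq' i' j', s.Candidate Cp' Cq' i' j' →
        s.edgeTime c Cp Cq i j ≤ s.edgeTime c Cp' Cq' i' j' :=
      fun Cp' Cq' i' j' h' => hqmin (Cp', Cq', i', j') h'
    rcases le_total (s.penaltyTime p C) (s.edgeTime c Cp Cq i j) with hle | hle
    · exact ⟨_, .penalty C hC hmin fun _ _ _ _ h' => hle.trans (hqmin' _ _ _ _ h')⟩
    · exact ⟨_, .edge Cp Cq i j hq hqmin' fun C' hC' => hle.trans (hmin C' hC')⟩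
  · exact ⟨_, .penalty C hC hmin fun Cp' Cq' i' j' h' => absurd ⟨(Cp', Cq', i', j'), h'⟩ hc⟩

/-! ### The combinatorial invariants of the growing phase -/

/-- The components partition V and are the connected pieces of the forest. The labels are laminar
and each lies in a component; `label_inner` makes the vertices missed by a pruned tree a union of
labels, and `inactive_labelled` is what forbids inactive leaves in that tree. -/
structure WellFormed (r : V) (s : PDState V) : Prop where
  cover : ∀ v, ∃ C ∈ s.comps, v ∈ C
  nonempty : ∀ C ∈ s.comps, C.Nonempty
  eq_of_mem : ∀ C ∈ s.comps, ∀ D ∈ s.comps, ∀ v, v ∈ C → v ∈ D → C = D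
  active_subset : s.active ⊆ s.comps
  root_notMem : ∀ C ∈ s.active, r ∉ C
  forest_inside : ∀ a b, s(a, b) ∈ s.forest → a ≠ b ∧ ∃ C ∈ s.comps, a ∈ C ∧ b ∈ C
  connected : ∀ C ∈ s.comps, ∀ a ∈ C, ∀ b ∈ C, (graphOf s.forest).Reachable a b
  label_mem : ∀ v L, s.label v = some L → v ∈ L
  label_subset : ∀ v L, s.label v = some L → ∃ C ∈ s.comps, L ⊆ C
  label_laminar : ∀ v L v' L', s.label v = some L → s.label v' = some L' →
    L ⊆ L' ∨ L' ⊆ L ∨ Disjoint L L'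
  label_inner : ∀ v L, s.label v = some L → ∀ u ∈ L, ∃ L', L' ⊆ L ∧ s.label u = some L'
  inactive_labelled : ∀ C ∈ s.comps, C ∉ s.active → r ∉ C → ∀ v ∈ C, ∃ L, s.label v = some L

namespace WellFormed

variable {r : V} {s : PDState V}

theorem init : WellFormed r (init r) where
  cover v := ⟨{v}, by simp [PDState.init], by simp⟩
  nonempty := by simp [PDState.init]
  eq_of_mem := by simp [PDState.init]
  active_subset := Finset.image_subset_image (Finset.subset_univ _)
  root_notMem := by
    simp only [PDState.init, Finset.mem_image, Finset.mem_erase]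
    rintro _ ⟨v, ⟨hv, _⟩, rfl⟩ hr
    exact hv (Finset.mem_singleton.1 hr).symm
  forest_inside := by simp [PDState.init]
  connected := by
    simp only [PDState.init, Finset.mem_image, Finset.mem_univ, true_and]
    rintro _ ⟨v, rfl⟩ a ha b hb
    rw [Finset.mem_singleton] at ha hb
    subst ha hb
    exact SimpleGraph.Reachable.refl _
  label_mem := by simp [PDState.init]
  label_subset := by simp [PDState.init]
  label_laminar := by simp [PDState.init]
  label_inner := by simp [PDState.init]
  inactive_labelled := by
    simp only [PDState.init, Finset.mem_image, Finset.mem_univ, true_and]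
    rintro _ ⟨v, rfl⟩ h hr
    rw [Finset.mem_singleton] at hr
    exact absurd ⟨v, Finset.mem_erase.2 ⟨Ne.symm hr, Finset.mem_univ v⟩, rfl⟩ h

theorem grow (h : WellFormed r s) (ε : ℝ) : WellFormed r (s.grow ε) := { h with }

theorem label_subset_of_mem (h : WellFormed r s) {C L : Finset V} {u v : V} (hC : C ∈ s.comps)
    (hL : s.label v = some L) (hu : u ∈ L) (huC : u ∈ C) : L ⊆ C := by
  obtain ⟨D, hD, hLD⟩ := h.label_subset v L hL
  rwa [h.eq_of_mem C hC D hD u huC (hLD hu)]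

theorem merge (h : WellFormed r s) {Cp Cq : Finset V} {i j : V} (hc : s.Candidate Cp Cq i j) :
    WellFormed r (s.merge r Cp Cq i j) := by
  have up : ∀ C ∈ s.comps, ∃ D ∈ insert (Cp ∪ Cq) ((s.comps.erase Cp).erase Cq), C ⊆ D := by
    intro C hC
    by_cases hp : C = Cp
    · exact ⟨_, Finset.mem_insert_self _ _, hp ▸ Finset.subset_union_left⟩
    by_cases hq : C = Cq
    · exact ⟨_, Finset.mem_insert_self _ _, hq ▸ Finset.subset_union_right⟩
    exact ⟨C, by simp [hp, hq, hC], subset_rfl⟩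
  have hij : i ≠ j := fun e => hc.ne
    (h.eq_of_mem _ hc.left_mem _ hc.right_mem i hc.i_mem (e ▸ hc.j_mem))
  have mono : graphOf s.forest ≤ graphOf (insert s(i, j) s.forest) :=
    graphOf_mono (Finset.subset_insert _ _)
  have hreach : (graphOf (insert s(i, j) s.forest)).Reachable i j :=
    SimpleGraph.Adj.reachable (graphOf_adj.2 ⟨Finset.mem_insert_self _ _, hij⟩)
  refine ⟨?_, ?_, ?_, ?_, ?_, ?_, ?_, h.label_mem, ?_, h.label_laminar, h.label_inner, ?_⟩
  · intro v
    obtain ⟨C, hC, hv⟩ := h.cover v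
    obtain ⟨D, hD, hCD⟩ := up C hC
    exact ⟨D, hD, hCD hv⟩
  · intro C hC
    rcases Finset.mem_insert.1 hC with rfl | hC
    · exact ⟨i, Finset.mem_union_left _ hc.i_mem⟩
    · exact h.nonempty C (Finset.mem_of_mem_erase (Finset.mem_of_mem_erase hC))
  · have aux : ∀ D ∈ (s.comps.erase Cp).erase Cq, ∀ v, v ∈ Cp ∪ Cq → v ∉ D := by
      intro D hD v hv hvD
      simp only [Finset.mem_erase, Finset.mem_union] at hD hv
      rcases hv with hv | hv
      · exact hD.2.1 (h.eq_of_mem D hD.2.2 Cp hc.left_mem v hvD hv)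
      · exact hD.1 (h.eq_of_mem D hD.2.2 Cq hc.right_mem v hvD hv)
    intro C hC D hD v hvC hvD
    rcases Finset.mem_insert.1 hC with rfl | hC <;> rcases Finset.mem_insert.1 hD with rfl | hD
    · rfl
    · exact absurd hvD (aux D hD v hvC)
    · exact absurd hvC (aux C hC v hvD)
    · exact h.eq_of_mem C (Finset.mem_of_mem_erase (Finset.mem_of_mem_erase hC)) D
        (Finset.mem_of_mem_erase (Finset.mem_of_mem_erase hD)) v hvC hvD
  · have : (s.active.erase Cp).erase Cq ⊆ (s.comps.erase Cp).erase Cq :=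
      Finset.erase_subset_erase _ (Finset.erase_subset_erase _ h.active_subset)
    simp only [PDState.merge]
    split_ifs
    · exact this.trans (Finset.subset_insert _ _)
    · exact Finset.insert_subset_insert _ this
  · have : ∀ C ∈ (s.active.erase Cp).erase Cq, r ∉ C := fun C hC =>
      h.root_notMem C (Finset.mem_of_mem_erase (Finset.mem_of_mem_erase hC))
    simp only [PDState.merge]
    split_ifs with hr
    · exact this
    · intro C hC
      rcases Finset.mem_insert.1 hC with rfl | hC
      · exact hr
      · exact this C hC
  · intro a b hab
    rcases Finset.mem_insert.1 hab with hab | hab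
    · have hi : i ∈ Cp ∪ Cq := Finset.mem_union_left _ hc.i_mem
      have hj : j ∈ Cp ∪ Cq := Finset.mem_union_right _ hc.j_mem
      rcases Sym2.eq_iff.1 hab with ⟨rfl, rfl⟩ | ⟨rfl, rfl⟩
      · exact ⟨hij, _, Finset.mem_insert_self _ _, hi, hj⟩
      · exact ⟨hij.symm, _, Finset.mem_insert_self _ _, hj, hi⟩
    · obtain ⟨hne, C, hC, ha, hb⟩ := h.forest_inside a b hab
      obtain ⟨D, hD, hCD⟩ := up C hC
      exact ⟨hne, D, hD, hCD ha, hCD hb⟩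
  · intro C hC
    rcases Finset.mem_insert.1 hC with rfl | hC
    · have toi : ∀ a ∈ Cp ∪ Cq, (graphOf (insert s(i, j) s.forest)).Reachable a i := by
        intro a ha
        rcases Finset.mem_union.1 ha with ha | ha
        · exact (h.connected Cp hc.left_mem a ha i hc.i_mem).mono mono
        · exact ((h.connected Cq hc.right_mem a ha j hc.j_mem).mono mono).trans hreach.symm
      exact fun a ha b hb => (toi a ha).trans (toi b hb).symm
    · exact fun a ha b hb => (h.connected C (Finset.mem_of_mem_erase
        (Finset.mem_of_mem_erase hC)) a ha b hb).mono mono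
  · intro v L hL
    obtain ⟨C, hC, hLC⟩ := h.label_subset v L hL
    obtain ⟨D, hD, hCD⟩ := up C hC
    exact ⟨D, hD, hLC.trans hCD⟩
  · simp only [PDState.merge]
    intro C hC hact hr v hv
    rcases Finset.mem_insert.1 hC with rfl | hC
    · simp [hr] at hact
    · have hC' := hC
      simp only [Finset.mem_erase] at hC'
      refine h.inactive_labelled C hC'.2.2 (fun hA => hact ?_) hr v hv
      split_ifs <;> simp [hC', hA]

theorem deactivate (h : WellFormed r s) {C : Finset V} (hC : C ∈ s.active) :
    WellFormed r (s.deactivate C) := by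
  have hCc := h.active_subset hC
  have hlab : ∀ v L, (s.deactivate C).label v = some L →
      s.label v = some L ∨ (v ∈ C ∧ L = C) := by
    intro v L hL
    simp only [PDState.deactivate] at hL
    split_ifs at hL with hv
    · exact .inr ⟨hv.1, (Option.some.inj hL).symm⟩
    · exact .inl hL
  have hlab' : ∀ v L, s.label v = some L → (s.deactivate C).label v = some L := by
    intro v L hL
    simp [PDState.deactivate, hL]
  have hlabC : ∀ v ∈ C, ∃ L, L ⊆ C ∧ (s.deactivate C).label v = some L := by
    intro v hv
    cases hl : s.label v with
    | none => exact ⟨C, subset_rfl, by simp [PDState.deactivate, hl, hv]⟩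
    | some L => exact ⟨L, h.label_subset_of_mem hCc hl (h.label_mem v L hl) hv, hlab' v L hl⟩
  have lam : ∀ v L, s.label v = some L → L ⊆ C ∨ Disjoint L C := by
    intro v L hL
    by_cases hd : Disjoint L C
    · exact .inr hd
    · obtain ⟨u, hu, huC⟩ := Finset.not_disjoint_iff.1 hd
      exact .inl (h.label_subset_of_mem hCc hL hu huC)
  refine ⟨h.cover, h.nonempty, h.eq_of_mem, (Finset.erase_subset _ _).trans h.active_subset,
    fun D hD => h.root_notMem D (Finset.mem_of_mem_erase hD), h.forest_inside, h.connected,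
    ?_, ?_, ?_, ?_, ?_⟩
  · intro v L hL
    rcases hlab v L hL with hL | ⟨hv, rfl⟩
    · exact h.label_mem v L hL
    · exact hv
  · intro v L hL
    rcases hlab v L hL with hL | ⟨_, rfl⟩
    · exact h.label_subset v L hL
    · exact ⟨L, hCc, subset_rfl⟩
  · intro v L v' L' hL hL'
    rcases hlab v L hL with h₁ | ⟨_, rfl⟩ <;> rcases hlab v' L' hL' with h₂ | ⟨_, rfl⟩
    · exact h.label_laminar v L v' L' h₁ h₂
    · rcases lam v L h₁ with h' | h'
      · exact .inl h'
      · exact .inr (.inr h')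
    · rcases lam v' L' h₂ with h' | h'
      · exact .inr (.inl h')
      · exact .inr (.inr h'.symm)
    · exact .inl subset_rfl
  · intro v L hL u hu
    rcases hlab v L hL with hL | ⟨_, rfl⟩
    · obtain ⟨L', hL', hl⟩ := h.label_inner v L hL u hu
      exact ⟨L', hL', hlab' u L' hl⟩
    · exact hlabC u hu
  · intro D hD hact hr v hv
    by_cases hDC : D = C
    · subst hDC
      obtain ⟨L, _, hL⟩ := hlabC v hv
      exact ⟨L, hL⟩
    · obtain ⟨L, hL⟩ := h.inactive_labelled D hD
        (fun hA => hact (Finset.mem_erase.2 ⟨hDC, hA⟩)) hr v hv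
      exact ⟨L, hlab' v L hL⟩

theorem step {c : Sym2 V → ℝ} {p : V → ℝ} {s' : PDState V} (h : WellFormed r s)
    (hs : Step c p r s s') : WellFormed r s' := by
  cases hs with
  | edge Cp Cq i j hc _ _ =>
    exact (h.grow _).merge (s := s.grow _) ⟨hc.1, hc.2, hc.3, hc.4, hc.5, hc.6⟩
  | penalty C hC _ _ => exact (h.grow _).deactivate (s := s.grow _) hC

theorem of_reachable {c : Sym2 V → ℝ} {p : V → ℝ} (h : Reachable c p r s) :
    WellFormed r s := by
  induction h with
  | refl => exact init
  | tail _ hs ih => exact ih.step hs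

end WellFormed

theorem Step.label_eq {c : Sym2 V → ℝ} {p : V → ℝ} {r : V} {s s' : PDState V}
    (h : Step c p r s s') {v : V} {L : Finset V} (hL : s.label v = some L) :
    s'.label v = some L := by
  cases h with
  | edge => exact hL
  | penalty => simp [deactivate, PDState.grow, hL]

theorem label_eq_of_reflTransGen {c : Sym2 V → ℝ} {p : V → ℝ} {r : V} {s s' : PDState V}
    (h : Relation.ReflTransGen (Step c p r) s s') {v : V} {L : Finset V}
    (hL : s.label v = some L) : s'.label v = some L := by
  induction h with
  | refl => exact hL
  | tail _ hs ih => exact hs.label_eq ih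

end PDState

namespace PDState

/-! ### Counting the edges of the pruned tree at the components -/

open Classical in
/-- The components that meet the vertex set `K`. -/
noncomputable def touched (s : PDState V) (K : Finset V) : Finset (Finset V) :=
  s.comps.filter (fun C => ¬ Disjoint C K)

theorem mem_touched {s : PDState V} {K C : Finset V} :
    C ∈ s.touched K ↔ C ∈ s.comps ∧ ∃ v ∈ C, v ∈ K := by
  simp [touched, Finset.not_disjoint_iff]

/-- The number of missing edges of F minus the number of touched components never decreases. If the
added edge is in F, both merged components meet K, so both numbers drop by one; otherwise no edge of
F stops being missing and merging cannot touch more components. -/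
theorem touched_step {c : Sym2 V → ℝ} {p : V → ℝ} {r : V} {s s' : PDState V}
    (h : Step c p r s s') {F : Finset (Sym2 V)} {K : Finset V}
    (hK : ∀ a b, s(a, b) ∈ F → a ∈ K ∧ b ∈ K) :
    (F \ s.forest).card + (s'.touched K).card ≤ (F \ s'.forest).card + (s.touched K).card := by
  cases h with
  | penalty => simp [touched, deactivate, grow]
  | edge Cp Cq i j h _ _ =>
    generalize s.edgeTime c Cp Cq i j = ε
    have hsub : (((s.grow ε).merge r Cp Cq i j).touched K) ⊆
        insert (Cp ∪ Cq) (((s.touched K).erase Cp).erase Cq) := by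
      intro C hC
      rw [mem_touched] at hC
      obtain ⟨hC, hv⟩ := hC
      rcases Finset.mem_insert.1 hC with rfl | hC
      · exact Finset.mem_insert_self _ _
      · simp only [grow, Finset.mem_erase] at hC
        refine Finset.mem_insert_of_mem ?_
        simp only [Finset.mem_erase, mem_touched]
        exact ⟨hC.1, hC.2.1, hC.2.2, hv⟩
    by_cases hF : s(i, j) ∈ F
    · have hp : Cp ∈ s.touched K := mem_touched.2 ⟨h.left_mem, i, h.i_mem, (hK i j hF).1⟩
      have hq : Cq ∈ (s.touched K).erase Cp :=
        Finset.mem_erase.2 ⟨h.ne.symm, mem_touched.2 ⟨h.right_mem, j, h.j_mem, (hK i j hF).2⟩⟩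
      have h₁ := Finset.card_erase_add_one hp
      have h₂ := Finset.card_erase_add_one hq
      have h₃ := (Finset.card_le_card hsub).trans (Finset.card_insert_le _ _)
      have h₄ : (F \ s.forest).card ≤
          (F \ ((s.grow ε).merge r Cp Cq i j).forest).card + 1 := by
        refine (Finset.card_le_card ?_).trans (Finset.card_insert_le s(i, j) _)
        intro e he
        simp only [merge, grow, Finset.mem_sdiff, Finset.mem_insert] at he ⊢
        tauto
      omega
    · have h₁ : F \ s.forest = F \ ((s.grow ε).merge r Cp Cq i j).forest := by
        ext e
        simp only [merge, grow, Finset.mem_sdiff, Finset.mem_insert]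
        by_cases he : e = s(i, j)
        · subst he; tauto
        · tauto
      have h₂ : (((s.grow ε).merge r Cp Cq i j).touched K).card ≤ (s.touched K).card := by
        by_cases hu : Cp ∪ Cq ∈ ((s.grow ε).merge r Cp Cq i j).touched K
        · obtain ⟨_, v, hv, hvK⟩ := mem_touched.1 hu
          have h₃ := (Finset.card_le_card hsub).trans (Finset.card_insert_le _ _)
          rcases Finset.mem_union.1 hv with hv | hv
          · have h₄ := Finset.card_erase_add_one (mem_touched.2 ⟨h.left_mem, v, hv, hvK⟩)
            have := Finset.card_erase_le (s := (s.touched K).erase Cp) (a := Cq)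
            omega
          · have h₄ := Finset.card_erase_add_one (mem_touched.2 ⟨h.right_mem, v, hv, hvK⟩)
            rw [Finset.erase_right_comm] at h₃
            have := Finset.card_erase_le (s := (s.touched K).erase Cq) (a := Cp)
            omega
        · refine Finset.card_le_card fun C hC => ?_
          rcases Finset.mem_insert.1 (hsub hC) with rfl | h'
          · exact absurd hC hu
          · exact Finset.mem_of_mem_erase (Finset.mem_of_mem_erase h')
      rw [h₁]
      omega

/-- At any time, the edges of a connected part of the final forest that are still missing from
the forest are fewer than the components that they connect. -/
theorem card_sdiff_forest_lt {c : Sym2 V → ℝ} {p : V → ℝ} {r : V} {s t : PDState V}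
    (h : Relation.ReflTransGen (Step c p r) s t) (hwf : WellFormed r s)
    {F : Finset (Sym2 V)} {K : Finset V}
    (hK : ∀ a b, s(a, b) ∈ F → a ∈ K ∧ b ∈ K) (hr : r ∈ K) (hF : F ⊆ t.forest) :
    (F \ s.forest).card < (s.touched K).card := by
  -- Backwards in time from the final state, where no edge of F is missing and the component of r is
  -- touched. This replaces an appeal to acyclicity of the forest.
  induction h using Relation.ReflTransGen.head_induction_on with
  | refl =>
    rw [Finset.sdiff_eq_empty_iff_subset.2 hF, Finset.card_empty, Finset.card_pos]
    obtain ⟨C, hC, hrC⟩ := hwf.cover r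
    exact ⟨C, mem_touched.2 ⟨hC, r, hrC, hr⟩⟩
  | head hs _ ih =>
    have h₁ := ih (hwf.step hs)
    have h₂ := touched_step hs hK
    omega

/-- Edges already in the forest lie inside components, so only missing edges are counted; each is
counted at most twice because components are disjoint. -/
theorem WellFormed.sum_card_inter_cut_le {r : V} {s : PDState V} (hwf : WellFormed r s)
    (F : Finset (Sym2 V)) {N : Finset (Finset V)} (hN : N ⊆ s.comps) :
    ∑ C ∈ N, (F ∩ cut C).card ≤ 2 * (F \ s.forest).card := by
  have h₁ : ∀ C ∈ N, (F ∩ cut C).card = ((F \ s.forest) ∩ cut C).card := by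
    intro C hC
    congr 1
    ext e
    induction e with
    | _ a b =>
      simp only [Finset.mem_inter, Finset.mem_sdiff, mem_cut]
      refine ⟨fun ⟨hF, hcut⟩ => ⟨⟨hF, fun hf => ?_⟩, hcut⟩, fun ⟨⟨hF, _⟩, hcut⟩ => ⟨hF, hcut⟩⟩
      obtain ⟨_, D, hD, ha, hb⟩ := hwf.forest_inside a b hf
      rcases hcut with ⟨h', h''⟩ | ⟨h', h''⟩
      · exact h'' (hwf.eq_of_mem C (hN hC) D hD a h' ha ▸ hb)
      · exact h' (hwf.eq_of_mem C (hN hC) D hD b h'' hb ▸ ha)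
  rw [Finset.sum_congr rfl h₁]
  generalize F \ s.forest = G
  have h₂ : ∀ C, (G ∩ cut C).card = ∑ e ∈ G, if e ∈ cut C then 1 else 0 := by
    intro C
    rw [← Finset.filter_mem_eq_inter, Finset.card_filter]
  simp_rw [h₂]
  rw [Finset.sum_comm, mul_comm, ← smul_eq_mul]
  refine Finset.sum_le_card_nsmul _ _ _ fun e _ => ?_
  induction e with
  | _ a b =>
    rw [← Finset.card_filter]
    have hone : ∀ v, (N.filter (fun C => v ∈ C)).card ≤ 1 := by
      intro v
      rw [Finset.card_le_one]
      intro C hC D hD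
      rw [Finset.mem_filter] at hC hD
      exact hwf.eq_of_mem C (hN hC.1) D (hN hD.1) v hC.2 hD.2
    calc _ ≤ (N.filter (fun C => a ∈ C) ∪ N.filter (fun C => b ∈ C)).card := by
          refine Finset.card_le_card fun C hC => ?_
          simp only [Finset.mem_filter, Finset.mem_union, mem_cut] at hC ⊢
          tauto
      _ ≤ 2 := (Finset.card_union_le _ _).trans (Nat.add_le_add (hone a) (hone b))

theorem WellFormed.card_active_lt {r : V} {s : PDState V} (hwf : WellFormed r s) :
    s.active.card + 1 ≤ Fintype.card V := by
  have h₁ : s.active.card ≤ (s.active.biUnion id).card := by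
    refine Finset.card_le_card_biUnion ?_ fun C hC => hwf.nonempty C (hwf.active_subset hC)
    intro C hC D hD hne
    refine Finset.disjoint_left.2 fun v hv hv' => hne ?_
    exact hwf.eq_of_mem C (hwf.active_subset hC) D (hwf.active_subset hD) v hv hv'
  have h₂ : s.active.biUnion id ⊆ Finset.univ.erase r := by
    intro v hv
    obtain ⟨C, hC, hv⟩ := Finset.mem_biUnion.1 hv
    refine Finset.mem_erase.2 ⟨?_, Finset.mem_univ v⟩
    rintro rfl
    exact hwf.root_notMem C hC hv
  have h₃ := Finset.card_le_card h₂
  have h₄ := Finset.card_erase_add_one (Finset.mem_univ r)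
  rw [Finset.card_univ] at h₄
  omega

/-- The average degree of the active components in the pruned tree is at most `2 - 1/(n-1)`. -/
theorem sum_active_card_inter_cut_le {c : Sym2 V → ℝ} {p : V → ℝ} {r : V} {s t : PDState V}
    (hn : 2 ≤ Fintype.card V) (hwf : WellFormed r s)
    (h : Relation.ReflTransGen (Step c p r) s t) (hwft : WellFormed r t) {F : Finset (Sym2 V)}
    (hF : IsPruned r t F) :
    (∑ C ∈ s.active, ((F ∩ cut C).card : ℝ)) ≤ (2 - 1 / ((Fintype.card V : ℝ) - 1)) *
      (s.active.filter (fun C => ¬ C ⊆ (spanned r F)ᶜ)).card := by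
  set K := spanned r F with hKdef
  have hK : ∀ a b, s(a, b) ∈ F → a ∈ K ∧ b ∈ K := fun a b hab =>
    ⟨hF.mem_spanned_left hab, hF.mem_spanned_right hab⟩
  set A := s.active.filter (fun C => ¬ C ⊆ Kᶜ) with hA
  have hmeet : ∀ C : Finset V, ¬ C ⊆ Kᶜ ↔ ∃ v ∈ C, v ∈ K := by
    intro C; simp [Finset.subset_iff]
  have hsum : ∑ C ∈ s.active, ((F ∩ cut C).card : ℝ) = ∑ C ∈ A, ((F ∩ cut C).card : ℝ) := by
    rw [hA, Finset.sum_filter_of_ne]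
    intro C _ hne
    rw [hmeet]
    obtain ⟨e, he⟩ := Finset.card_ne_zero.1 (by exact_mod_cast hne : (F ∩ cut C).card ≠ 0)
    induction e with
    | _ a b =>
      rw [Finset.mem_inter, mem_cut] at he
      have := hK a b he.1
      rcases he.2 with h' | h'
      · exact ⟨a, h'.1, this.1⟩
      · exact ⟨b, h'.2, this.2⟩
  rw [hsum, ← Nat.cast_sum]
  have hcardV : (0 : ℝ) < (Fintype.card V : ℝ) - 1 := by
    have : (2 : ℝ) ≤ Fintype.card V := by exact_mod_cast hn
    linarith
  rcases A.eq_empty_or_nonempty with hAe | hAne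
  · simp [hAe]
  have hAN : A ⊆ s.touched K := by
    intro C hC
    rw [hA, Finset.mem_filter, hmeet] at hC
    exact mem_touched.2 ⟨hwf.active_subset hC.1, hC.2⟩
  obtain ⟨R, hR, hrR⟩ := hwf.cover r
  have hRN : R ∈ s.touched K \ A := by
    refine Finset.mem_sdiff.2 ⟨mem_touched.2 ⟨hR, r, hrR, root_mem_spanned r F⟩, fun h' => ?_⟩
    exact hwf.root_notMem R (Finset.mem_filter.1 h').1 hrR
  -- The tree reaches an active component, which is not R, so it must leave R.
  have hRdeg : 1 ≤ (F ∩ cut R).card := by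
    obtain ⟨C, hC⟩ := hAne
    rw [hA, Finset.mem_filter, hmeet] at hC
    obtain ⟨hC, v, hv, hvK⟩ := hC
    refine Finset.card_pos.2 (exists_mem_cut hvK fun hiff => ?_)
    rw [hwf.eq_of_mem C (hwf.active_subset hC) R hR v hv (hiff.1 hrR)] at hC
    exact hwf.root_notMem R hC hrR
  -- These components are inactive and avoid r. The tree reaches them, so the degree is not 0; all
  -- their vertices already carry labels inside them, so pruning excludes degree 1.
  have hdeg : ∀ C ∈ (s.touched K \ A).erase R, 2 ≤ (F ∩ cut C).card := by
    intro C hC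
    rw [Finset.mem_erase, Finset.mem_sdiff, mem_touched] at hC
    obtain ⟨hCR, ⟨hCc, v, hv, hvK⟩, hCA⟩ := hC
    have hrC : r ∉ C := fun h' => hCR (hwf.eq_of_mem C hCc R hR r h' hrR)
    have hCact : C ∉ s.active := fun h' =>
      hCA (Finset.mem_filter.2 ⟨h', (hmeet C).2 ⟨v, hv, hvK⟩⟩)
    have h₀ : (F ∩ cut C).card ≠ 0 :=
      Finset.card_ne_zero.2 (exists_mem_cut hvK fun hiff => hrC (hiff.2 hv))
    have h₁ : (F ∩ cut C).card ≠ 1 := by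
      refine hF.card_inter_cut_ne_one hrC hwft.label_mem fun u hu => ?_
      obtain ⟨L, hL⟩ := hwf.inactive_labelled C hCc hCact hrC u hu
      exact ⟨L, hwf.label_subset_of_mem hCc hL (hwf.label_mem u L hL) hu,
        label_eq_of_reflTransGen h hL⟩
    omega
  have hlt := card_sdiff_forest_lt h hwf hK (root_mem_spanned r F) hF.1.subset
  have hle := hwf.sum_card_inter_cut_le F (N := s.touched K)
    (fun C hC => (mem_touched.1 hC).1)
  have hs₁ := Finset.sum_sdiff (f := fun C => (F ∩ cut C).card) hAN
  have hs₂ := Finset.add_sum_erase _ (fun C => (F ∩ cut C).card) hRN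
  have hs₃ := Finset.card_nsmul_le_sum _ (fun C => (F ∩ cut C).card) 2 hdeg
  have hc₁ := Finset.card_sdiff_add_card_eq_card hAN
  have hc₂ := Finset.card_erase_add_one hRN
  have hAcard : A.card + 1 ≤ Fintype.card V :=
    (Nat.add_le_add_right (Finset.card_filter_le _ _) 1).trans hwf.card_active_lt
  simp only [smul_eq_mul] at hs₃
  -- With N touched components, the degrees total at most 2(N - 1). Removing at least 1 for R and 2
  -- for each of the N - |A| - 1 other inactive ones leaves at most 2|A| - 1.
  have hfin : (∑ C ∈ A, (F ∩ cut C).card) + 1 ≤ 2 * A.card := by omega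
  have hfin' : ((∑ C ∈ A, (F ∩ cut C).card : ℕ) : ℝ) + 1 ≤ 2 * A.card := by exact_mod_cast hfin
  have hAc : (A.card : ℝ) + 1 ≤ Fintype.card V := by exact_mod_cast hAcard
  -- There are at most n - 1 active components, so the saved 1 is worth at least 1/(n-1) for each of
  -- them.
  have hdiv : (1 / ((Fintype.card V : ℝ) - 1)) * A.card ≤ 1 := by
    rw [one_div_mul_eq_div, div_le_one hcardV]
    linarith
  linarith

end PDState

namespace PDState

/-! ### The dual solution constructed by the growing phase -/

/-- Raise the dual variables of the sets in `A` by `ε`. -/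
def raise (A : Finset (Finset V)) (ε : ℝ) (Y : Finset V → ℝ) : Finset V → ℝ :=
  fun S => Y S + if S ∈ A then ε else 0

theorem sum_raise (A : Finset (Finset V)) (ε : ℝ) (Y f : Finset V → ℝ) :
    ∑ S, raise A ε Y S * f S = ∑ S, Y S * f S + ε * ∑ S ∈ A, f S := by
  simp only [raise, add_mul, Finset.sum_add_distrib, ite_mul, zero_mul, Finset.sum_ite_mem,
    Finset.univ_inter, Finset.mul_sum]

theorem sum_filter_raise (A : Finset (Finset V)) (ε : ℝ) (Y : Finset V → ℝ)
    (P : Finset V → Prop) [DecidablePred P] :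
    ∑ S with P S, raise A ε Y S = ∑ S with P S, Y S + ε * (A.filter P).card := by
  simp only [raise, Finset.sum_add_distrib, Finset.sum_ite_mem]
  rw [Finset.sum_const, nsmul_eq_mul, mul_comm, Finset.filter_inter, Finset.univ_inter]

/-- `Y` is the dual solution at the state `s`, for the costs `c` and penalties `p`. The last
condition compares `Y`, weighted by an antitone function `g` of the sets, with the penalties. -/
structure IsDual (c : Sym2 V → ℝ) (p z : V → ℝ) (g : Finset V → ℝ) (r : V) (s : PDState V)
    (Y : Finset V → ℝ) : Prop where
  nonneg : ∀ S, 0 ≤ Y S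
  support : ∀ S, Y S ≠ 0 → S.Nonempty ∧ r ∉ S ∧ ∃ C ∈ s.comps, S ⊆ C
  w_eq : ∀ C ∈ s.comps, s.w C = ∑ S with S ⊆ C, Y S
  d_eq : ∀ v, s.d v = ∑ S with v ∈ S, Y S
  w_le : ∀ C ∈ s.comps, s.w C ≤ ∑ v ∈ C, p v
  edge_le : ∀ a b, a ≠ b → ∑ S with s(a, b) ∈ cut S, Y S ≤ c s(a, b)
  le_edge : ∀ e ∈ s.forest, c e ≤ ∑ S with e ∈ cut S, Y S
  le_label : ∀ v L, s.label v = some L → ∑ u ∈ L, p u ≤ ∑ S with S ⊆ L, Y S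
  weighted : ∀ C ∈ s.comps,
    ∑ S with S ⊆ C, Y S * (g S - g C) ≤ ∑ v ∈ C, p v * (z v - g C)

namespace IsDual

variable {c : Sym2 V → ℝ} {p z : V → ℝ} {g : Finset V → ℝ} {r : V} {s : PDState V}
  {Y : Finset V → ℝ}

theorem init (hc : ∀ i j, 0 ≤ c s(i, j)) (hp : ∀ v, 0 ≤ p v) (hg : ∀ v, g {v} ≤ z v) :
    IsDual c p z g r (init r) (fun _ => 0) where
  nonneg _ := le_rfl
  support _ h := absurd rfl h
  w_eq := by simp [PDState.init]
  d_eq := by simp [PDState.init]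
  w_le C _ := Finset.sum_nonneg fun v _ => hp v
  edge_le a b _ := by simpa using hc a b
  le_edge := by simp [PDState.init]
  le_label := by simp [PDState.init]
  weighted := by
    simp only [PDState.init, Finset.mem_image, Finset.mem_univ, true_and]
    rintro _ ⟨v, rfl⟩
    simpa using mul_nonneg (hp v) (sub_nonneg.2 (hg v))

/-- The dual variables of sets containing exactly one end of an edge between two components. -/
theorem sum_cut_eq (h : IsDual c p z g r s Y) (hwf : WellFormed r s) {Cp Cq : Finset V}
    (hp : Cp ∈ s.comps) (hq : Cq ∈ s.comps) (hne : Cp ≠ Cq) {i j : V} (hi : i ∈ Cp)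
    (hj : j ∈ Cq) : ∑ S with s(i, j) ∈ cut S, Y S = s.d i + s.d j := by
  rw [h.d_eq, h.d_eq, Finset.sum_filter, Finset.sum_filter, Finset.sum_filter,
    ← Finset.sum_add_distrib]
  refine Finset.sum_congr rfl fun S _ => ?_
  by_cases hY : Y S = 0
  · simp [hY]
  obtain ⟨_, _, C, hC, hSC⟩ := h.support S hY
  have hnot : ¬ (i ∈ S ∧ j ∈ S) := fun ⟨hiS, hjS⟩ => hne <|
    (hwf.eq_of_mem _ hp _ hC i hi (hSC hiS)).trans (hwf.eq_of_mem _ hC _ hq j (hSC hjS) hj)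
  simp only [mem_cut]
  by_cases hiS : i ∈ S <;> by_cases hjS : j ∈ S <;> simp [hiS, hjS]
  exact absurd ⟨hiS, hjS⟩ hnot

theorem card_active_mem (hwf : WellFormed r s) {C : Finset V} (hC : C ∈ s.comps) {v : V}
    (hv : v ∈ C) : ((s.active.filter (fun S => v ∈ S)).card : ℝ) = s.lam C := by
  by_cases hA : C ∈ s.active
  · have : s.active.filter (fun S => v ∈ S) = {C} := by
      ext S
      rw [Finset.mem_filter, Finset.mem_singleton]
      refine ⟨fun ⟨hS, hvS⟩ => ?_, fun h => h ▸ ⟨hA, hv⟩⟩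
      exact hwf.eq_of_mem S (hwf.active_subset hS) C hC v hvS hv
    simp [this, lam, hA]
  · have : s.active.filter (fun S => v ∈ S) = ∅ := by
      refine Finset.filter_eq_empty_iff.2 fun S hS hvS => hA ?_
      rwa [← hwf.eq_of_mem S (hwf.active_subset hS) C hC v hvS hv]
    simp [this, lam, hA]

theorem filter_active_subset (hwf : WellFormed r s) {C : Finset V} (hC : C ∈ s.comps) :
    s.active.filter (fun S => S ⊆ C) = if C ∈ s.active then {C} else ∅ := by
  have huniq : ∀ S ∈ s.active, S ⊆ C → S = C := by
    intro S hS hSC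
    obtain ⟨v, hv⟩ := hwf.nonempty S (hwf.active_subset hS)
    exact hwf.eq_of_mem S (hwf.active_subset hS) C hC v hv (hSC hv)
  split_ifs with hA
  · ext S
    rw [Finset.mem_filter, Finset.mem_singleton]
    exact ⟨fun ⟨hS, hSC⟩ => huniq S hS hSC, fun h => ⟨h ▸ hA, h.le⟩⟩
  · refine Finset.filter_eq_empty_iff.2 fun S hS hSC => hA ?_
    rwa [← huniq S hS hSC]

theorem sum_le_sum_raise {ε : ℝ} (hε : 0 ≤ ε) (A : Finset (Finset V)) (Y : Finset V → ℝ)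
    (P : Finset V → Prop) [DecidablePred P] :
    ∑ S with P S, Y S ≤ ∑ S with P S, raise A ε Y S := by
  rw [sum_filter_raise]
  exact le_add_of_nonneg_right (by positivity)

theorem grow (h : IsDual c p z g r s Y) (hwf : WellFormed r s) {ε : ℝ} (hε : 0 ≤ ε)
    (hedge : ∀ Cp Cq i j, s.Candidate Cp Cq i j → ε ≤ s.edgeTime c Cp Cq i j)
    (hpen : ∀ C ∈ s.active, ε ≤ s.penaltyTime p C) :
    IsDual c p z g r (s.grow ε) (raise s.active ε Y) where
  nonneg S := by
    have := h.nonneg S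
    unfold raise
    split_ifs <;> linarith
  support S hS := by
    by_cases hA : S ∈ s.active
    · exact ⟨hwf.nonempty S (hwf.active_subset hA), hwf.root_notMem S hA, S,
        hwf.active_subset hA, subset_rfl⟩
    · exact h.support S (by simpa [raise, hA] using hS)
  w_eq C hC := by
    rw [sum_filter_raise, filter_active_subset hwf hC, ← h.w_eq C hC]
    simp only [PDState.grow]
    split_ifs <;> simp
  d_eq v := by
    rw [sum_filter_raise, ← h.d_eq]
    obtain ⟨C, hC, hv⟩ := hwf.cover v
    rw [card_active_mem hwf hC hv]
    have : (∃ D ∈ s.active, v ∈ D) ↔ C ∈ s.active := by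
      refine ⟨fun ⟨D, hD, hvD⟩ => ?_, fun hA => ⟨C, hA, hv⟩⟩
      rwa [← hwf.eq_of_mem D (hwf.active_subset hD) C hC v hvD hv]
    simp only [PDState.grow, this, lam]
    split_ifs <;> simp
  w_le C hC := by
    have := h.w_le C hC
    simp only [PDState.grow]
    split_ifs with hA
    · have := hpen C hA
      unfold penaltyTime at this
      linarith
    · exact this
  edge_le a b hab := by
    have hab' := h.edge_le a b hab
    rw [sum_filter_raise]
    obtain ⟨Cp, hp, ha⟩ := hwf.cover a
    obtain ⟨Cq, hq, hb⟩ := hwf.cover b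
    by_cases hne : Cp = Cq
    · have : s.active.filter (fun S => s(a, b) ∈ cut S) = ∅ := by
        refine Finset.filter_eq_empty_iff.2 fun S hS hcut => ?_
        have hSc := hwf.active_subset hS
        rcases mem_cut.1 hcut with ⟨h₁, h₂⟩ | ⟨h₁, h₂⟩
        · exact h₂ (hwf.eq_of_mem S hSc Cp hp a h₁ ha ▸ hne ▸ hb)
        · exact h₁ (hwf.eq_of_mem S hSc Cq hq b h₂ hb ▸ hne ▸ ha)
      simpa [this] using hab'
    · have hcard : ((s.active.filter (fun S => s(a, b) ∈ cut S)).card : ℝ) ≤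
          s.lam Cp + s.lam Cq := by
        rw [← card_active_mem hwf hp ha, ← card_active_mem hwf hq hb, ← Nat.cast_add]
        refine Nat.cast_le.2 ((Finset.card_le_card fun S hS => ?_).trans
          (Finset.card_union_le _ _))
        simp only [Finset.mem_filter, Finset.mem_union, mem_cut] at hS ⊢
        tauto
      by_cases hgr : Cp ∈ s.active ∨ Cq ∈ s.active
      · have hpos : 0 < s.lam Cp + s.lam Cq := by
          unfold lam
          rcases hgr with hA | hA <;> simp only [hA, if_true] <;> split_ifs <;> norm_num
        have ht := hedge Cp Cq a b ⟨hp, hq, hne, ha, hb, hgr⟩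
        rw [edgeTime, le_div_iff₀ hpos] at ht
        rw [h.sum_cut_eq hwf hp hq hne ha hb]
        have := mul_le_mul_of_nonneg_left hcard hε
        linarith
      · have hz : s.lam Cp + s.lam Cq = 0 := by
          rw [not_or] at hgr
          simp [lam, hgr.1, hgr.2]
        have := mul_le_mul_of_nonneg_left hcard hε
        rw [hz] at this
        linarith
  le_edge e he := (h.le_edge e he).trans (sum_le_sum_raise hε _ _ _)
  le_label v L hL := (h.le_label v L hL).trans (sum_le_sum_raise hε _ _ _)
  weighted C hC := by
    -- Among the subsets of C only C itself can be active, and its weight g C - g C is zero: growing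
    -- leaves the sum unchanged.
    refine le_trans (le_of_eq ?_) (h.weighted C hC)
    refine Finset.sum_congr rfl fun S hS => ?_
    rw [Finset.mem_filter] at hS
    unfold raise
    split_ifs with hA
    · obtain ⟨v, hv⟩ := hwf.nonempty S (hwf.active_subset hA)
      rw [hwf.eq_of_mem S (hwf.active_subset hA) C hC v hv (hS.2 hv)]
      ring
    · ring

/-- Sets with nonzero dual variable are nonempty and lie inside one component, so none straddles Cp
and Cq. -/
theorem sum_subset_union (h : IsDual c p z g r s Y) (hwf : WellFormed r s) {Cp Cq : Finset V}
    (hp : Cp ∈ s.comps) (hq : Cq ∈ s.comps) (hne : Cp ≠ Cq) (f : Finset V → ℝ) :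
    ∑ S with S ⊆ Cp ∪ Cq, Y S * f S =
      ∑ S with S ⊆ Cp, Y S * f S + ∑ S with S ⊆ Cq, Y S * f S := by
  rw [Finset.sum_filter, Finset.sum_filter, Finset.sum_filter, ← Finset.sum_add_distrib]
  refine Finset.sum_congr rfl fun S _ => ?_
  by_cases hY : Y S = 0
  · simp [hY]
  obtain ⟨⟨v, hv⟩, _, C, hC, hSC⟩ := h.support S hY
  have hiff : S ⊆ Cp ∪ Cq ↔ S ⊆ Cp ∨ S ⊆ Cq := by
    refine ⟨fun hS => ?_, fun hS => hS.elim (fun h' => h'.trans Finset.subset_union_left)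
      fun h' => h'.trans Finset.subset_union_right⟩
    rcases Finset.mem_union.1 (hS hv) with h' | h'
    · exact .inl (hwf.eq_of_mem C hC Cp hp v (hSC hv) h' ▸ hSC)
    · exact .inr (hwf.eq_of_mem C hC Cq hq v (hSC hv) h' ▸ hSC)
  have hnot : ¬ (S ⊆ Cp ∧ S ⊆ Cq) := fun ⟨h₁, h₂⟩ =>
    hne (hwf.eq_of_mem Cp hp Cq hq v (h₁ hv) (h₂ hv))
  by_cases h₁ : S ⊆ Cp <;> by_cases h₂ : S ⊆ Cq <;> simp [hiff, h₁, h₂]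
  exact absurd ⟨h₁, h₂⟩ hnot

theorem merge (h : IsDual c p z g r s Y) (hwf : WellFormed r s) (hg : Antitone g)
    {Cp Cq : Finset V} {i j : V} (hc : s.Candidate Cp Cq i j)
    (ht : c s(i, j) ≤ s.d i + s.d j) : IsDual c p z g r (s.merge r Cp Cq i j) Y := by
  have hdisj : Disjoint Cp Cq := Finset.disjoint_left.2 fun v hv hv' =>
    hc.ne (hwf.eq_of_mem _ hc.left_mem _ hc.right_mem v hv hv')
  have hne : ∀ C ∈ (s.comps.erase Cp).erase Cq, C ∈ s.comps ∧ C ≠ Cp ∪ Cq := by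
    intro C hC
    simp only [Finset.mem_erase] at hC
    refine ⟨hC.2.2, fun he => hC.2.1 ?_⟩
    exact hwf.eq_of_mem C hC.2.2 Cp hc.left_mem i (he ▸ Finset.mem_union_left _ hc.i_mem)
      hc.i_mem
  refine ⟨h.nonneg, ?_, ?_, h.d_eq, ?_, h.edge_le, ?_, h.le_label, ?_⟩
  · intro S hS
    obtain ⟨hn, hr, C, hC, hSC⟩ := h.support S hS
    refine ⟨hn, hr, ?_⟩
    by_cases hp : C = Cp
    · exact ⟨_, Finset.mem_insert_self _ _, hSC.trans (hp ▸ Finset.subset_union_left)⟩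
    by_cases hq : C = Cq
    · exact ⟨_, Finset.mem_insert_self _ _, hSC.trans (hq ▸ Finset.subset_union_right)⟩
    exact ⟨C, Finset.mem_insert_of_mem (by simp [hp, hq, hC]), hSC⟩
  · intro C hC
    rcases Finset.mem_insert.1 hC with rfl | hC
    · have := h.sum_subset_union hwf hc.left_mem hc.right_mem hc.ne (fun _ => 1)
      simp only [mul_one] at this
      simp [PDState.merge, this, h.w_eq Cp hc.left_mem, h.w_eq Cq hc.right_mem]
    · obtain ⟨hC, hCne⟩ := hne C hC
      simp [PDState.merge, Function.update_of_ne hCne, h.w_eq C hC]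
  · intro C hC
    rcases Finset.mem_insert.1 hC with rfl | hC
    · rw [Finset.sum_union hdisj]
      simpa [PDState.merge] using add_le_add (h.w_le Cp hc.left_mem) (h.w_le Cq hc.right_mem)
    · obtain ⟨hC, hCne⟩ := hne C hC
      simpa [PDState.merge, Function.update_of_ne hCne] using h.w_le C hC
  · intro e he
    rcases Finset.mem_insert.1 he with rfl | he
    · rwa [h.sum_cut_eq hwf hc.left_mem hc.right_mem hc.ne hc.i_mem hc.j_mem]
    · exact h.le_edge e he
  -- Lowering the reference level from g C to g (Cp ∪ Cq) adds the nonnegative difference times w C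
  -- on the left and times p(C) on the right, and w C ≤ p(C).
  · have part : ∀ C ∈ s.comps, C ⊆ Cp ∪ Cq → ∑ S with S ⊆ C, Y S * (g S - g (Cp ∪ Cq)) ≤
        ∑ v ∈ C, p v * (z v - g (Cp ∪ Cq)) := by
      intro C hC hsub
      have h₁ := h.weighted C hC
      have h₂ := mul_le_mul_of_nonneg_right (h.w_le C hC) (sub_nonneg.2 (hg hsub))
      rw [h.w_eq C hC, Finset.sum_mul, Finset.sum_mul] at h₂
      have h₃ := add_le_add h₁ h₂
      rw [← Finset.sum_add_distrib, ← Finset.sum_add_distrib] at h₃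
      exact (Finset.sum_congr rfl fun S _ => by ring).trans_le
        (h₃.trans_eq (Finset.sum_congr rfl fun v _ => by ring))
    intro C hC
    rcases Finset.mem_insert.1 hC with rfl | hC
    · rw [Finset.sum_union hdisj, h.sum_subset_union hwf hc.left_mem hc.right_mem hc.ne]
      exact add_le_add (part Cp hc.left_mem Finset.subset_union_left)
        (part Cq hc.right_mem Finset.subset_union_right)
    · exact h.weighted C (hne C hC).1

theorem deactivate (h : IsDual c p z g r s Y) {C : Finset V} (hC : C ∈ s.comps)
    (ht : ∑ v ∈ C, p v ≤ s.w C) : IsDual c p z g r (s.deactivate C) Y := by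
  refine ⟨h.nonneg, h.support, h.w_eq, h.d_eq, h.w_le, h.edge_le, h.le_edge, ?_, h.weighted⟩
  intro v L hL
  simp only [PDState.deactivate] at hL
  split_ifs at hL with hv
  · rw [← Option.some.inj hL, ← h.w_eq C hC]
    exact ht
  · exact h.le_label v L hL

/-- An iteration of the growing phase raises the dual variables of the active components by some
`ε ≥ 0`. -/
theorem step (h : IsDual c p z g r s Y) (hwf : WellFormed r s) (hg : Antitone g)
    {s' : PDState V} (hs : Step c p r s s') :
    ∃ ε, 0 ≤ ε ∧ IsDual c p z g r s' (raise s.active ε Y) := by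
  have hlam : ∀ {Cp Cq i j}, s.Candidate Cp Cq i j → 0 < s.lam Cp + s.lam Cq := by
    intro Cp Cq i j hc
    unfold lam
    rcases hc.grows with hA | hA <;> simp only [hA, if_true] <;> split_ifs <;> norm_num
  cases hs with
  | edge Cp Cq i j hc hedge hpen =>
    have hij : i ≠ j := fun e => hc.ne
      (hwf.eq_of_mem _ hc.left_mem _ hc.right_mem i hc.i_mem (e ▸ hc.j_mem))
    have hε : 0 ≤ s.edgeTime c Cp Cq i j := by
      have := h.edge_le i j hij
      rw [h.sum_cut_eq hwf hc.left_mem hc.right_mem hc.ne hc.i_mem hc.j_mem] at this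
      exact div_nonneg (by linarith) (hlam hc).le
    refine ⟨_, hε, (h.grow hwf hε hedge hpen).merge (hwf.grow _) hg
      ⟨hc.1, hc.2, hc.3, hc.4, hc.5, hc.6⟩ ?_⟩
    have hd : ∀ {C v}, C ∈ s.comps → v ∈ C → ∀ ε, (s.grow ε).d v = s.d v + ε * s.lam C := by
      intro C v hC hv ε
      have : (∃ D ∈ s.active, v ∈ D) ↔ C ∈ s.active := by
        refine ⟨fun ⟨D, hD, hvD⟩ => ?_, fun hA => ⟨C, hA, hv⟩⟩
        rwa [← hwf.eq_of_mem D (hwf.active_subset hD) C hC v hvD hv]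
      simp only [PDState.grow, this, lam]
      split_ifs <;> simp
    rw [hd hc.left_mem hc.i_mem, hd hc.right_mem hc.j_mem]
    have : s.edgeTime c Cp Cq i j * (s.lam Cp + s.lam Cq) = c s(i, j) - s.d i - s.d j :=
      div_mul_cancel₀ _ (hlam hc).ne'
    linarith
  | penalty C hC hpen hedge =>
    have hε : 0 ≤ s.penaltyTime p C := sub_nonneg.2 (h.w_le C (hwf.active_subset hC))
    refine ⟨_, hε, (h.grow hwf hε hedge hpen).deactivate (hwf.active_subset hC) ?_⟩
    simp [PDState.grow, hC, penaltyTime]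

end IsDual

/-- Every execution constructs a dual solution that pays for each tree that may be obtained by
pruning in the end. -/
theorem exists_isDual {c : Sym2 V → ℝ} {p z : V → ℝ} {g : Finset V → ℝ} {r : V} {s : PDState V}
    (hn : 2 ≤ Fintype.card V) (hc : ∀ i j, 0 ≤ c s(i, j)) (hp : ∀ v, 0 ≤ p v)
    (hg : Antitone g) (hgz : ∀ v, g {v} ≤ z v) (h : Reachable c p r s) :
    ∃ Y, IsDual c p z g r s Y ∧ ∀ t F, Relation.ReflTransGen (Step c p r) s t → IsPruned r t F →
      ∑ S, Y S * (F ∩ cut S).card ≤ (2 - 1 / ((Fintype.card V : ℝ) - 1)) *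
        ∑ S with ¬ S ⊆ (spanned r F)ᶜ, Y S := by
  -- The bound is carried for every later outcome (t, F), since each raise of the dual variables is
  -- charged to a tree that is only known at the end.
  induction h with
  | refl => exact ⟨_, IsDual.init hc hp hgz, by simp⟩
  | @tail s s' h hs ih =>
    obtain ⟨Y, hY, hfut⟩ := ih
    have hwf := WellFormed.of_reachable h
    obtain ⟨ε, hε, hY'⟩ := hY.step hwf hg hs
    refine ⟨_, hY', fun t F ht hF => ?_⟩
    have hst := Relation.ReflTransGen.head hs ht
    have h₁ := hfut t F hst hF
    have h₂ := sum_active_card_inter_cut_le hn hwf hst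
      (WellFormed.of_reachable (h.trans hst)) hF
    rw [sum_raise, sum_filter_raise]
    have h₃ := mul_le_mul_of_nonneg_left h₂ hε
    linarith

end PDState

/-! ### The final state -/

namespace PDState

/-- The penalties of a union of labels are paid for by the dual variables of its subsets. -/
theorem IsDual.sum_penalty_le {c : Sym2 V → ℝ} {p z : V → ℝ} {g : Finset V → ℝ} {r : V}
    {s : PDState V} {Y : Finset V → ℝ} (h : IsDual c p z g r s Y) (hwf : WellFormed r s)
    (U : Finset V) (hU : ∀ v ∈ U, ∃ L, s.label v = some L ∧ L ⊆ U) :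
    ∑ v ∈ U, p v ≤ ∑ S with S ⊆ U, Y S := by
  suffices H : ∀ U : Finset V, (∀ v ∈ U, ∃ u L, s.label u = some L ∧ v ∈ L ∧ L ⊆ U) →
      ∑ v ∈ U, p v ≤ ∑ S with S ⊆ U, Y S from
    H U fun v hv => let ⟨L, hL, hLU⟩ := hU v hv; ⟨v, L, hL, hwf.label_mem v L hL, hLU⟩
  intro U
  induction U using Finset.strongInduction with
  | H U ih =>
    intro hU
    rcases U.eq_empty_or_nonempty with rfl | ⟨w, hw⟩
    · simpa using Finset.sum_nonneg fun S _ => h.nonneg S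
    obtain ⟨u₀, L₀, hL₀, hwL₀, hL₀U⟩ := hU w hw
    -- Take a largest label L inside U. By laminarity every other label inside U is contained in L
    -- or disjoint from it, so U \ L is again a union of labels.
    obtain ⟨L, ⟨⟨u, hL⟩, hLU⟩, hmax⟩ := Set.exists_max_image
      {L : Finset V | (∃ u, s.label u = some L) ∧ L ⊆ U} Finset.card (Set.toFinite _)
      ⟨L₀, ⟨u₀, hL₀⟩, hL₀U⟩
    have huL := hwf.label_mem u L hL
    have hrest : ∀ v ∈ U \ L, ∃ u L', s.label u = some L' ∧ v ∈ L' ∧ L' ⊆ U \ L := by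
      intro v hv
      rw [Finset.mem_sdiff] at hv
      obtain ⟨u', L', hL', hvL', hL'U⟩ := hU v hv.1
      refine ⟨u', L', hL', hvL', fun a ha => Finset.mem_sdiff.2 ⟨hL'U ha, fun haL => ?_⟩⟩
      rcases hwf.label_laminar u L u' L' hL hL' with hsub | hsub | hd
      · rw [Finset.eq_of_subset_of_card_le hsub (hmax L' ⟨⟨u', hL'⟩, hL'U⟩)] at hv
        exact hv.2 hvL'
      · exact hv.2 (hsub hvL')
      · exact Finset.disjoint_left.1 hd haL ha
    have hlt : U \ L ⊂ U := by
      refine Finset.ssubset_iff_subset_ne.2 ⟨Finset.sdiff_subset, fun he => ?_⟩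
      have := hLU huL
      rw [← he, Finset.mem_sdiff] at this
      exact this.2 huL
    have h₁ := ih _ hlt hrest
    have h₂ := h.le_label u L hL
    rw [← Finset.sum_sdiff hLU]
    refine (add_le_add h₁ h₂).trans ?_
    rw [Finset.sum_filter, Finset.sum_filter, Finset.sum_filter, ← Finset.sum_add_distrib]
    refine Finset.sum_le_sum fun S _ => ?_
    by_cases hY : Y S = 0
    · simp [hY]
    obtain ⟨⟨v, hv⟩, _⟩ := h.support S hY
    have hS := h.nonneg S
    by_cases h₃ : S ⊆ U \ L
    · have h₄ : ¬ S ⊆ L := fun h' => (Finset.mem_sdiff.1 (h₃ hv)).2 (h' hv)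
      simp [h₃, h₄, h₃.trans Finset.sdiff_subset]
    · by_cases h₄ : S ⊆ L
      · simp [h₃, h₄, h₄.trans hLU]
      · simp only [h₃, h₄, if_false, add_zero]
        split_ifs <;> linarith

/-- Adding g C times `w_le` to `weighted` removes the reference level g C. The components partition
V, and each set in the support of Y lies in one of them. -/
theorem IsDual.sum_mul_le {c : Sym2 V → ℝ} {p z : V → ℝ} {g : Finset V → ℝ} {r : V}
    {s : PDState V} {Y : Finset V → ℝ} (h : IsDual c p z g r s Y) (hwf : WellFormed r s)
    (hg : ∀ S, 0 ≤ g S) : ∑ S, Y S * g S ≤ ∑ v, p v * z v := by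
  have hcomp : ∀ C ∈ s.comps, ∑ S with S ⊆ C, Y S * g S ≤ ∑ v ∈ C, p v * z v := by
    intro C hC
    have h₁ := h.weighted C hC
    have h₂ := mul_le_mul_of_nonneg_right (h.w_le C hC) (hg C)
    rw [h.w_eq C hC, Finset.sum_mul, Finset.sum_mul] at h₂
    simp only [mul_sub, Finset.sum_sub_distrib] at h₁
    linarith
  have hbi : s.comps.biUnion id = Finset.univ := by
    ext v
    simpa using hwf.cover v
  calc ∑ S, Y S * g S ≤ ∑ S, ∑ C ∈ s.comps, if S ⊆ C then Y S * g S else 0 := by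
        refine Finset.sum_le_sum fun S _ => ?_
        have hnn : ∀ C ∈ s.comps, 0 ≤ if S ⊆ C then Y S * g S else 0 := fun C _ => by
          split_ifs
          exacts [mul_nonneg (h.nonneg S) (hg S), le_rfl]
        by_cases hY : Y S = 0
        · simp [hY]
        obtain ⟨_, _, C, hC, hSC⟩ := h.support S hY
        simpa [hSC] using Finset.single_le_sum hnn hC
    _ = ∑ C ∈ s.comps, ∑ S with S ⊆ C, Y S * g S := by
        rw [Finset.sum_comm]
        simp_rw [Finset.sum_filter]
    _ ≤ ∑ C ∈ s.comps, ∑ v ∈ C, p v * z v := Finset.sum_le_sum hcomp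
    _ = ∑ v, p v * z v := by
        rw [← hbi, Finset.sum_biUnion]
        · rfl
        · intro C hC D hD hne
          exact Finset.disjoint_left.2 fun v hv hv' => hne (hwf.eq_of_mem C hC D hD v hv hv')

/-- The forest connects r to exactly its own component. All other components are inactive, hence
fully labelled, and no label crosses a component. -/
theorem WellFormed.admissible_forest {r : V} {s : PDState V} (hwf : WellFormed r s)
    (h : s.Halted) : Admissible r s s.forest := by
  obtain ⟨R, hR, hrR⟩ := hwf.cover r
  have hiff : ∀ v, (graphOf s.forest).Reachable r v ↔ v ∈ R := by
    refine fun v => ⟨fun hv => ?_, fun hv => hwf.connected R hR r hrR v hv⟩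
    refine reachable_induction (fun v => v ∈ R) hv hrR fun a b _ hab _ ha => ?_
    obtain ⟨_, D, hD, haD, hbD⟩ := hwf.forest_inside a b hab
    rwa [hwf.eq_of_mem R hR D hD a ha haD]
  refine ⟨subset_rfl, fun v hv => ?_, fun v v' C C' hv hv' hCC' hr => ?_⟩
  · rw [hiff]
    obtain ⟨C, hC, hvC⟩ := hwf.cover v
    by_cases hrC : r ∈ C
    · rwa [hwf.eq_of_mem R hR C hC r hrR hrC]
    · obtain ⟨L, hL⟩ := hwf.inactive_labelled C hC (by simp [show s.active = ∅ from h]) hrC v hvC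
      simp [hv] at hL
  · rw [hiff] at hr ⊢
    exact hwf.label_subset_of_mem hR hv' (hCC' (hwf.label_mem v C hv)) hr
      (hwf.label_mem v' C' hv')

end PDState

/-! ### Linear programming duality -/

theorem edgeCost_nonneg {c : Sym2 V → ℝ} (hc : ∀ i j, 0 ≤ c s(i, j)) {r : V} {x : Sym2 V → ℝ}
    {y : V → ℝ} (h : Feasible r x y) : 0 ≤ edgeCost c x := by
  refine Finset.sum_nonneg fun e he => mul_nonneg ?_ (h.x_bounds e he).1
  induction e with
  | _ i j => exact hc i j

/-- `max_{v ∈ S} y v`, which is `0` for the empty set. -/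
noncomputable def supOn (y : V → ℝ) (S : Finset V) : ℝ := (S.sup fun v => (y v).toNNReal : NNReal)

theorem supOn_mono (y : V → ℝ) : Monotone (supOn y) := fun _ _ h =>
  NNReal.coe_le_coe.2 (Finset.sup_mono h)

theorem le_supOn_singleton (y : V → ℝ) (v : V) : y v ≤ supOn y {v} := by
  simp [supOn]

theorem supOn_le {y : V → ℝ} {S : Finset V} {a : ℝ} (ha : 0 ≤ a) (h : ∀ v ∈ S, y v ≤ a) :
    supOn y S ≤ a := by
  rw [supOn, ← Real.coe_toNNReal a ha, NNReal.coe_le_coe]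
  exact Finset.sup_le fun v hv => Real.toNNReal_le_toNNReal (h v hv)

/-- A dual solution is bounded by the cost of every feasible solution of the relaxation. -/
theorem Feasible.sum_dual_le {c : Sym2 V → ℝ} {p : V → ℝ} {r : V} {x : Sym2 V → ℝ}
    {y : V → ℝ} (h : Feasible r x y) {s : PDState V} {Y : Finset V → ℝ}
    (hwf : s.WellFormed r)
    (hY : s.IsDual c p (fun v => 1 - y v) (fun S => 1 - supOn y S) r Y) :
    ∑ S, Y S ≤ edgeCost c x / 2 + ∑ v, p v * (1 - y v) := by
  have h₁ := hY.sum_mul_le hwf fun S =>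
    sub_nonneg.2 (supOn_le zero_le_one fun v _ => (h.y_bounds v).2)
  -- Weak duality for the cut constraints: all constraints for S and v ∈ S together say 2 max_S y ≤
  -- x(δ(S)), and exchanging the sums leaves the dual load of each edge, at most its cost.
  have h₂ : ∑ S, Y S * (2 * supOn y S) ≤ edgeCost c x := by
    calc ∑ S, Y S * (2 * supOn y S) ≤ ∑ S, Y S * ∑ e ∈ cut S, x e := by
          refine Finset.sum_le_sum fun S _ => ?_
          by_cases hS : Y S = 0
          · simp [hS]
          refine mul_le_mul_of_nonneg_left ?_ (hY.nonneg S)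
          have hx : 0 ≤ ∑ e ∈ cut S, x e := Finset.sum_nonneg fun e he =>
            (h.x_bounds e (Finset.mem_filter.1 he).1).1
          have := supOn_le (div_nonneg hx zero_le_two) fun v hv =>
            (le_div_iff₀' zero_lt_two).2 (h.cuts S (hY.support S hS).2.1 v hv)
          linarith
      _ = ∑ S, ∑ e ∈ edges V, if e ∈ cut S then Y S * x e else 0 := by
          refine Finset.sum_congr rfl fun S _ => ?_
          rw [← Finset.sum_filter, Finset.mul_sum]
          refine Finset.sum_congr ?_ fun _ _ => rfl
          rw [Finset.filter_mem_eq_inter]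
          exact (Finset.inter_eq_right.2 (Finset.filter_subset _ _)).symm
      _ = ∑ e ∈ edges V, (∑ S with e ∈ cut S, Y S) * x e := by
          rw [Finset.sum_comm]
          simp_rw [Finset.sum_filter, Finset.sum_mul, ite_mul, zero_mul]
      _ ≤ edgeCost c x := by
          refine Finset.sum_le_sum fun e he => mul_le_mul_of_nonneg_right ?_ (h.x_bounds e he).1
          induction e with
          | _ a b => exact hY.edge_le a b (by simpa [edges] using he)
  have h₃ : ∑ S, Y S * (2 * supOn y S) = 2 * (∑ S, Y S - ∑ S, Y S * (1 - supOn y S)) := by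
    rw [← Finset.sum_sub_distrib, Finset.mul_sum]
    exact Finset.sum_congr rfl fun S _ => by ring
  linarith

/-! ### Doubling the tree and shortcutting -/

/-- The length of the walk from `a` along the list `l`. -/
def walkLength (f : V → V → ℝ) : V → List V → ℝ
  | _, [] => 0
  | a, b :: l => f a b + walkLength f b l

theorem walkLength_cons_le {f : V → V → ℝ} (htri : ∀ i j k, f i k ≤ f i j + f j k) (a x : V)
    {l : List V} (hl : l ≠ []) : walkLength f a l ≤ f a x + walkLength f x l := by
  cases l with
  | nil => exact absurd rfl hl
  | cons b l =>
    have := htri a x b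
    simp only [walkLength]
    linarith

/-- The fixed last vertex b keeps the lists nonempty, so dropping a vertex is one use of the
triangle inequality, without nonnegativity of f. -/
theorem walkLength_sublist_le {f : V → V → ℝ} (htri : ∀ i j k, f i k ≤ f i j + f j k) (b : V)
    {T L : List V} (h : T.Sublist L) (a : V) :
    walkLength f a (T ++ [b]) ≤ walkLength f a (L ++ [b]) := by
  induction h generalizing a with
  | slnil => exact le_rfl
  | cons x _ ih =>
    exact (walkLength_cons_le htri a x (by simp)).trans (add_le_add_right (ih x) _)
  | cons_cons x _ ih => exact add_le_add_right (ih x) _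

theorem walkLength_append_singleton_le {f : V → V → ℝ} (htri : ∀ i j k, f i k ≤ f i j + f j k)
    (x y : V) (l : List V) (a : V) :
    walkLength f a (l ++ [x]) ≤ walkLength f a (l ++ [y]) + f y x := by
  induction l generalizing a with
  | nil => simpa [walkLength] using htri a y x
  | cons b l ih =>
    have := ih b
    simp only [List.cons_append, walkLength]
    linarith

theorem sum_zipWith_append (f : V → V → ℝ) (t b : V) (T : List V) :
    (List.zipWith f (t :: T) (T ++ [b])).sum = walkLength f t (T ++ [b]) := by
  induction T generalizing t with
  | nil => simp [walkLength]
  | cons x T ih => simp only [List.cons_append, List.zipWith_cons_cons, List.sum_cons, ih,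
      walkLength]

/-- The lengths of the edges of `c`, with loops of length `0`. -/
def edgeDist (c : Sym2 V → ℝ) (u v : V) : ℝ := if u = v then 0 else c s(u, v)

/-- The values of c on the diagonal may be positive, while the lists of vertices used below repeat r
at the ends. Loops of length 0 make these repetitions free and preserve the triangle inequality. -/
theorem IsMetric.edgeDist_triangle {c : Sym2 V → ℝ} (hc : IsMetric c) (i j k : V) :
    edgeDist c i k ≤ edgeDist c i j + edgeDist c j k := by
  unfold edgeDist
  by_cases hij : i = j
  · subst hij; simp
  by_cases hjk : j = k
  · subst hjk; simp
  simp only [hij, hjk, if_false]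
  split_ifs
  · exact add_nonneg (hc.nonneg _ _) (hc.nonneg _ _)
  · exact hc.triangle _ _ _

theorem walkLength_tail_support {G : SimpleGraph V} (c : Sym2 V → ℝ) {u v : V} (p : G.Walk u v) :
    walkLength (edgeDist c) u (p.support.tail ++ [v]) = (p.edges.map c).sum := by
  induction p with
  | nil => simp [walkLength, edgeDist]
  | @cons u v w h q ih =>
    rw [SimpleGraph.Walk.support_cons, List.tail_cons, ← SimpleGraph.Walk.cons_tail_support,
      List.cons_append, walkLength, ih, SimpleGraph.Walk.edges_cons, List.map_cons, List.sum_cons,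
      edgeDist, if_neg h.ne]

/-- Shortcutting a closed walk does not increase the cost. -/
theorem cycleCost_le_of_sublist {c : Sym2 V → ℝ} (hc : IsMetric c) {G : SimpleGraph V} {r : V}
    (p : G.Walk r r) {T : List V} (hT : T.Sublist p.support) (hnd : T.Nodup) :
    cycleCost c T ≤ (p.edges.map c).sum := by
  have htri := hc.edgeDist_triangle
  have hlen : ∀ T' : List V, T'.Sublist p.support →
      walkLength (edgeDist c) r (T' ++ [r]) ≤ (p.edges.map c).sum := by
    intro T' hT'
    refine (walkLength_sublist_le htri r hT' r).trans_eq ?_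
    rw [← SimpleGraph.Walk.cons_tail_support, List.cons_append, walkLength,
      walkLength_tail_support]
    simp [edgeDist]
  unfold cycleCost
  split_ifs with h2
  · cases T with
    | nil => simp at h2
    | cons t T =>
      -- Cyclically consecutive vertices differ, because there are at least two and none is
      -- repeated; so no loop occurs. The last index, where the list wraps around to t, is separate.
      have hzip : List.zipWith (fun u v => c s(u, v)) (t :: T) ((t :: T).rotate 1) =
          List.zipWith (edgeDist c) (t :: T) (T ++ [t]) := by
        rw [List.rotate_cons_succ, List.rotate_zero]
        refine List.ext_getElem (by simp) fun i hi₁ hi₂ => ?_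
        rw [List.getElem_zipWith, List.getElem_zipWith, edgeDist, if_neg]
        intro he
        have hi : i < T.length + 1 := by simpa using hi₁
        rw [List.nodup_cons] at hnd
        by_cases hlast : i = T.length
        · subst hlast
          rw [List.getElem_append_right le_rfl] at he
          simp only [Nat.sub_self, List.getElem_singleton] at he
          have : 0 < T.length := Nat.lt_of_succ_le (by simpa using h2)
          rw [List.getElem_cons, dif_neg this.ne'] at he
          exact hnd.1 (he ▸ List.getElem_mem _)
        · rw [List.getElem_append_left (by omega)] at he
          have hnd' : (t :: T).Nodup := List.nodup_cons.2 hnd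
          have h3 : (t :: T)[i] = (t :: T)[i + 1]'(by simp; omega) := he
          have := (hnd'.getElem_inj_iff).1 h3
          omega
      rw [hzip, sum_zipWith_append]
      refine le_trans ?_ (hlen _ hT)
      -- Instead of returning directly to t, the tour may return to r and go on to t.
      have := walkLength_append_singleton_le htri t r T t
      rw [List.cons_append, walkLength]
      linarith
  · simpa [walkLength, edgeDist] using hlen [] (List.nil_sublist _)

/-- A closed walk through `r` that uses exactly the edges of `F`, each of them twice. -/
theorem exists_walk_count_eq_two {r : V} {F : Finset (Sym2 V)}
    (hF : ∀ a b, s(a, b) ∈ F → a ≠ b ∧ a ∈ spanned r F) :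
    ∃ p : (graphOf F).Walk r r, ∀ e ∈ F, p.edges.count e = 2 := by
  -- A largest edge set that a closed walk can traverse exactly twice. If an edge ab outside it
  -- starts on the walk, the detour a, b, a can be spliced in; so the walk covers everything
  -- connected to r.
  obtain ⟨E, ⟨hE, p, hp⟩, hmax⟩ := Set.exists_max_image
    {E : Finset (Sym2 V) | E ⊆ F ∧ ∃ p : (graphOf F).Walk r r,
      ∀ e, p.edges.count e = if e ∈ E then 2 else 0} Finset.card (Set.toFinite _)
    ⟨∅, Finset.empty_subset _, SimpleGraph.Walk.nil, by simp⟩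
  have hext : ∀ a b, s(a, b) ∈ F → a ∈ p.support → s(a, b) ∈ E := by
    intro a b hab ha
    by_contra hnot
    have hadj : (graphOf F).Adj a b := graphOf_adj.2 ⟨hab, (hF a b hab).1⟩
    have := hmax (insert s(a, b) E) ⟨Finset.insert_subset hab hE,
      (p.takeUntil a ha).append (((SimpleGraph.Walk.nil.cons hadj.symm).cons hadj).append
        (p.dropUntil a ha)), fun e => ?_⟩
    · rw [Finset.card_insert_of_notMem hnot] at this
      omega
    · have hc := hp e
      rw [← p.take_spec ha, SimpleGraph.Walk.edges_append, List.count_append] at hc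
      simp only [SimpleGraph.Walk.edges_append, SimpleGraph.Walk.edges_cons,
        SimpleGraph.Walk.edges_nil, List.count_append, List.count_cons, List.count_nil,
        Finset.mem_insert, Sym2.eq_swap (a := b) (b := a), beq_iff_eq]
      by_cases he : e = s(a, b)
      · subst he
        simp only [hnot, if_false] at hc
        simp
        omega
      · simp only [he, Ne.symm he, if_false, false_or]
        omega
  have hsupp : ∀ v ∈ spanned r F, v ∈ p.support := by
    intro v hv
    refine reachable_induction (fun v => v ∈ p.support) (mem_spanned.1 hv)
      p.start_mem_support fun a b _ hab _ ha => ?_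
    have h₁ := hext a b hab ha
    refine p.snd_mem_support_of_mem_edges (t := a) (u := b) (List.count_pos_iff.1 ?_)
    rw [hp, if_pos h₁]
    exact two_pos
  refine ⟨p, fun e he => ?_⟩
  induction e with
  | _ a b => rw [hp, if_pos (hext a b he (hsupp a (hF a b he).2))]

theorem exists_returns {r : V} {s : PDState V} (hwf : s.WellFormed r) (h : s.Halted) :
    ∃ T, Returns r s T := by
  obtain ⟨F, -, hF⟩ := exists_minimal_le_of_wellFoundedLT (Admissible r s) s.forest
    (hwf.admissible_forest h)
  have hF' : IsPruned r s F := hF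
  obtain ⟨p, hp⟩ := exists_walk_count_eq_two (r := r) (F := F) fun a b hab =>
    ⟨(hwf.forest_inside a b (hF.1.subset hab)).1, hF'.mem_spanned_left hab⟩
  exact ⟨p.support.dedup, h, F, hF', p, hp, List.dedup_sublist _, List.nodup_dedup _,
    fun v hv => List.mem_dedup.2 hv⟩

theorem IsDoubledTreeTour.mem_iff {r : V} {F : Finset (Sym2 V)} {T : List V}
    (h : IsDoubledTreeTour r F T) {v : V} : v ∈ T ↔ v ∈ spanned r F := by
  obtain ⟨p, hp, hsub, _, hmem⟩ := h
  refine ⟨fun hv => mem_spanned.2 ⟨p.takeUntil v (hsub.subset hv)⟩, fun hv => hmem v ?_⟩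
  refine reachable_induction (fun v => v ∈ p.support) (mem_spanned.1 hv)
    p.start_mem_support fun a b _ hab _ _ => ?_
  refine p.snd_mem_support_of_mem_edges (t := a) (u := b) (List.count_pos_iff.1 ?_)
  rw [hp _ hab]
  exact two_pos

theorem IsDoubledTreeTour.isCycleThrough {r : V} {F : Finset (Sym2 V)} {T : List V}
    (h : IsDoubledTreeTour r F T) : IsCycleThrough r T :=
  ⟨let ⟨_, _, _, hnd, _⟩ := h; hnd, h.mem_iff.2 (root_mem_spanned r F)⟩

theorem IsDoubledTreeTour.cycleCost_le {c : Sym2 V → ℝ} (hc : IsMetric c) {r : V}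
    {F : Finset (Sym2 V)} {T : List V} (h : IsDoubledTreeTour r F T) :
    cycleCost c T ≤ 2 * ∑ e ∈ F, c e := by
  obtain ⟨p, hp, hsub, hnd, _⟩ := h
  refine (cycleCost_le_of_sublist hc p hsub hnd).trans_eq ?_
  have hset : p.edges.toFinset = F := by
    ext e
    rw [List.mem_toFinset]
    refine ⟨fun he => ?_, fun he => List.count_pos_iff.1 (by rw [hp e he]; exact two_pos)⟩
    have := p.edges_subset_edgeSet he
    simp only [SimpleGraph.edgeSet_fromEdgeSet, Set.mem_sdiff, Finset.mem_coe] at this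
    exact this.1
  rw [Finset.sum_list_map_count, hset, Finset.mul_sum]
  refine Finset.sum_congr rfl fun e he => ?_
  rw [hp e he, nsmul_eq_mul, Nat.cast_two]

/-! ### The main theorem -/

theorem alwaysReturns (c : Sym2 V → ℝ) (π : V → ℝ) (r : V) : AlwaysReturns c π r := by
  refine ⟨PDState.acc_step _ _ _ _, fun s hs => ?_⟩
  rcases s.active.eq_empty_or_nonempty with h | h
  · exact .inr (exists_returns (PDState.WellFormed.of_reachable hs) h)
  · exact .inl (PDState.exists_step _ _ _ s h)

/-- The guarantee of the algorithm for the prize-collecting Steiner tree, compared with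
the value of the relaxation in which the edge costs are halved. -/
theorem sum_pruned_le {c : Sym2 V → ℝ} {p : V → ℝ} {r : V} (hn : 2 ≤ Fintype.card V)
    (hc : ∀ i j, 0 ≤ c s(i, j)) (hp : ∀ v, 0 ≤ p v) {x : Sym2 V → ℝ} {y : V → ℝ}
    (hxy : Feasible r x y) {s : PDState V} (hs : PDState.Reachable c p r s)
    {F : Finset (Sym2 V)} (hF : IsPruned r s F) :
    ∑ e ∈ F, c e + (2 - 1 / ((Fintype.card V : ℝ) - 1)) * ∑ v ∈ (spanned r F)ᶜ, p v ≤
      (2 - 1 / ((Fintype.card V : ℝ) - 1)) *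
        (edgeCost c x / 2 + ∑ v, p v * (1 - y v)) := by
  have hwf := PDState.WellFormed.of_reachable hs
  obtain ⟨Y, hY, hfut⟩ := PDState.exists_isDual (z := fun v => 1 - y v)
    (g := fun S => 1 - supOn y S) hn hc hp (fun S T h => sub_le_sub_left (supOn_mono y h) 1)
    (fun v => sub_le_sub_left (le_supOn_singleton y v) 1) hs
  have h₁ := hfut s F .refl hF
  have hcost : ∑ e ∈ F, c e ≤ ∑ S, Y S * (F ∩ cut S).card := by
    calc ∑ e ∈ F, c e ≤ ∑ e ∈ F, ∑ S with e ∈ cut S, Y S :=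
          Finset.sum_le_sum fun e he => hY.le_edge e (hF.1.subset he)
      _ = ∑ S, ∑ e ∈ F, if e ∈ cut S then Y S else 0 := by
          simp_rw [Finset.sum_filter]
          exact Finset.sum_comm
      _ = ∑ S, Y S * (F ∩ cut S).card := by
          refine Finset.sum_congr rfl fun S _ => ?_
          rw [← Finset.sum_filter, Finset.filter_mem_eq_inter, Finset.sum_const, nsmul_eq_mul,
            mul_comm]
  -- A missed vertex has a label L. The labels of the vertices of L lie in L, so if one of them were
  -- connected to r, admissibility would force v to be connected as well.
  have hpen := hY.sum_penalty_le hwf (spanned r F)ᶜ fun v hv => by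
    rw [Finset.mem_compl, mem_spanned] at hv
    cases hl : s.label v with
    | none => exact absurd (hF.1.unlabelled v hl) hv
    | some L =>
      refine ⟨L, rfl, fun u hu => ?_⟩
      rw [Finset.mem_compl, mem_spanned]
      obtain ⟨L', hL', hl'⟩ := hwf.label_inner v L hl u hu
      exact fun hr => hv (hF.1.labelled u v L' L hl' hl hL' hr)
  have hsplit := Finset.sum_filter_add_sum_filter_not Finset.univ
    (fun S => S ⊆ (spanned r F)ᶜ) Y
  have hdual := hxy.sum_dual_le hwf hY
  have hα : 0 ≤ 2 - 1 / ((Fintype.card V : ℝ) - 1) := by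
    have h2 : (2 : ℝ) ≤ Fintype.card V := by exact_mod_cast hn
    have : 1 / ((Fintype.card V : ℝ) - 1) ≤ 1 := by
      rw [div_le_one (by linarith)]
      linarith
    linarith
  calc _ ≤ (2 - 1 / ((Fintype.card V : ℝ) - 1)) * ∑ S with ¬ S ⊆ (spanned r F)ᶜ, Y S +
        (2 - 1 / ((Fintype.card V : ℝ) - 1)) * ∑ S with S ⊆ (spanned r F)ᶜ, Y S :=
        add_le_add (hcost.trans h₁) (mul_le_mul_of_nonneg_left hpen hα)
    _ = (2 - 1 / ((Fintype.card V : ℝ) - 1)) * ∑ S, Y S := by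
        rw [← mul_add, ← hsplit, add_comm]
    _ ≤ _ := mul_le_mul_of_nonneg_left hdual hα

end PCTSP

theorem proposition2 {V : Type*} [Fintype V] [DecidableEq V] (hn : 2 ≤ Fintype.card V)
    (c : Sym2 V → ℝ) (hc : PCTSP.IsMetric c) (r : V) (π : V → ℝ) (hπ : ∀ v, 0 ≤ π v)
    (x : Sym2 V → ℝ) (y : V → ℝ) (hxy : PCTSP.IsOptimum c π r x y) :
    PCTSP.AlwaysReturns c (PCTSP.scaledPenalty π) r ∧
      ∀ T : List V, PCTSP.IsOutput c (PCTSP.scaledPenalty π) r T →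
        PCTSP.IsCycleThrough r T ∧
          PCTSP.cycleCost c T + PCTSP.missedPenalty π T ≤
            2 * PCTSP.edgeCost c x + PCTSP.penaltyCost π y := by
  refine ⟨PCTSP.alwaysReturns _ _ _, fun T ⟨s, hs, _, F, hF, hT⟩ => ⟨hT.isCycleThrough, ?_⟩⟩
  have h2 : (2 : ℝ) ≤ Fintype.card V := by exact_mod_cast hn
  have hinv : 1 / ((Fintype.card V : ℝ) - 1) ≤ 1 := by
    rw [div_le_one (by linarith)]
    linarith
  have hinv₀ : 0 ≤ 1 / ((Fintype.card V : ℝ) - 1) := div_nonneg zero_le_one (by linarith)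
  have hp : ∀ v, 0 ≤ PCTSP.scaledPenalty π v / 2 := fun v =>
    div_nonneg (mul_nonneg (div_nonneg zero_le_one (by linarith)) (hπ v)) zero_le_two
  have key := PCTSP.sum_pruned_le hn hc.nonneg hp hxy.1 hs hF
  have hcost := hT.cycleCost_le hc
  have hx := PCTSP.edgeCost_nonneg hc.nonneg hxy.1
  -- One factor 2 comes from doubling the tree and compensates the halved penalties; the other
  -- factor undoes the scaling.
  have hscale : ∀ v, 2 * (2 - 1 / ((Fintype.card V : ℝ) - 1)) *
      (PCTSP.scaledPenalty π v / 2) = π v := by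
    intro v
    have : 2 - 1 / ((Fintype.card V : ℝ) - 1) ≠ 0 := by linarith
    unfold PCTSP.scaledPenalty
    field_simp
  have hmissed : PCTSP.missedPenalty π T = 2 * (2 - 1 / ((Fintype.card V : ℝ) - 1)) *
      ∑ v ∈ (PCTSP.spanned r F)ᶜ, PCTSP.scaledPenalty π v / 2 := by
    rw [Finset.mul_sum]
    refine Finset.sum_congr ?_ fun v _ => (hscale v).symm
    ext v
    simp [hT.mem_iff]
  have hpen : PCTSP.penaltyCost π y = 2 * (2 - 1 / ((Fintype.card V : ℝ) - 1)) *
      ∑ v, PCTSP.scaledPenalty π v / 2 * (1 - y v) := by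
    rw [Finset.mul_sum]
    exact Finset.sum_congr rfl fun v _ => by rw [← mul_assoc, hscale]
  -- The doubled bound has (2 - 1/(n-1)) c(x) on the right; the nonnegative term c(x)/(n-1) is given
  -- away.
  have hx' := mul_nonneg hinv₀ hx
  rw [hmissed, hpen]
  linarith
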